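/- Let $d\geq 5$, let $\mathcal A=\{0,\dots,d-1\}$, and let $T_d$ be the $d$-regular rooted tree, whose vertices are the finite words over $\mathcal A$. For $g\in\operatorname{Aut}(T_d)$ write $g=(g_0,\dots,g_{d-1})\rho$ if $g(xw)=\rho(x)\,g_x(w)$ for every letter $x$ and every finite word $w$, where $\rho$ is a permutation of $\mathcal A$ and $g_x\in\operatorname{Aut}(T_d)$; a permutation of $\mathcal A$ is identified with the automorphism that applies it to the first letter of every word. The alternating mother group $M\leq\operatorname{Aut}(T_d)$ is the group generated by $A\cup B$, where $A$ is the alternating group of $\mathcal A$ acting on the first letter, and $B$ is the set of all $g\in\operatorname{Aut}(T_d)$ with $g=(g,\sigma_1,\dots,\sigma_{d-1})\rho$ for some even permutations $\sigma_1,\dots,\sigma_{d-1},\rho$ of $\mathcal A$ such that $\rho(0)=0$. Let $\operatorname{Sub}(M)\subset\{0,1\}^M$ be the space of subgroups of $M$ with the topology induced by the product topology, on which $M$ acts by conjugation, and let $X\subset\operatorname{Sub}(M)$ be the Schreier dynamical system of $M$, i.e. the closure of the set of stabilisers $\operatorname{Stab}_M(\gamma)$ of those points $\gamma$ of the boundary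 $\partial T_d=\mathcal A^{\mathbb N}$ at which the map $\operatorname{Stab}_M\colon\partial T_d\to\operatorname{Sub}(M)$ is continuous. Let $[[M]]$ be the topological full group of $M\curvearrowright X$, i.e. the group of all homeomorphisms $h$ of $X$ such that every $x\in X$ has a neighbourhood on which $h$ coincides with the action of some element of $M$. Let $[[M]]_t$ be the subgroup of $[[M]]$ generated by its elements of finite order, and let $[[M]]_t'$ be the commutator subgroup of $[[M]]_t$. Then $[[M]]_t'$ is finitely generated. -/

import Mathlib

open Topology Filter

namespace MotherGroup

/-! ## The rooted tree, its automorphisms and its boundary -/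

/-- Vertices of the `d`-regular rooted tree: finite words in the alphabet `{0, …, d-1}`.
The root is the empty word, and `u` is an ancestor of `v` iff `u` is a prefix of `v`. -/
abbrev Vertex (d : ℕ) : Type := List (Fin d)

/-- `Aut(T_d)`: the permutations of the vertices that preserve the levels and the
ancestor relation. -/
def treeAut (d : ℕ) : Subgroup (Equiv.Perm (Vertex d)) where
  carrier := {g | (∀ v, (g v).length = v.length) ∧ ∀ u v, g u <+: g v ↔ u <+: v}
  one_mem' := ⟨fun _ => rfl, fun _ _ => Iff.rfl⟩
  mul_mem' := by
    rintro g h ⟨hg, hg'⟩ ⟨hh, hh'⟩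
    refine ⟨fun v => ?_, fun u v => ?_⟩
    · rw [Equiv.Perm.mul_apply, hg, hh]
    · rw [Equiv.Perm.mul_apply, Equiv.Perm.mul_apply, hg', hh']
  inv_mem' := by
    rintro g ⟨hg, hg'⟩
    refine ⟨fun v => ?_, fun u v => ?_⟩
    · exact ((hg (g.symm v)).symm.trans (by rw [g.apply_symm_apply]))
    · exact ((hg' (g.symm u) (g.symm v)).symm.trans
        (by rw [g.apply_symm_apply, g.apply_symm_apply]))

/-- The wreath recursion `g = (s_0, …, s_{d-1}) ρ`: the automorphism `g` permutes the first level
by `ρ`, and its section at the letter `x` is `s x`. -/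
def HasWreathRecursion {d : ℕ} (g : treeAut d) (s : Fin d → treeAut d) (ρ : Equiv.Perm (Fin d)) :
    Prop :=
  ∀ (x : Fin d) (w : Vertex d), g.1 (x :: w) = ρ x :: (s x).1 w

/-- A permutation of the first letter of a word. -/
def rootedFun {d : ℕ} (σ : Equiv.Perm (Fin d)) : Vertex d → Vertex d
  | [] => []
  | x :: w => σ x :: w

/-- A permutation `σ` of the alphabet, seen as the automorphism of the tree that permutes the
first level by `σ` and acts trivially below. -/
def rooted {d : ℕ} (σ : Equiv.Perm (Fin d)) : treeAut d where
  val :=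
    { toFun := rootedFun σ
      invFun := rootedFun σ⁻¹
      left_inv := by rintro (_ | ⟨x, w⟩) <;> simp [rootedFun]
      right_inv := by rintro (_ | ⟨x, w⟩) <;> simp [rootedFun] }
  property := by
    refine ⟨?_, ?_⟩
    · rintro (_ | ⟨x, w⟩) <;> simp [rootedFun]
    · rintro (_ | ⟨x, w⟩) (_ | ⟨y, w'⟩) <;> simp [rootedFun, List.cons_prefix_cons]

/-- The boundary of the tree: infinite words, with the product topology. -/
def Boundary (d : ℕ) : Type := ℕ → Fin d

instance (d : ℕ) : TopologicalSpace (Boundary d) :=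
  inferInstanceAs (TopologicalSpace (ℕ → Fin d))

/-- The prefix of length `n` of an infinite word. -/
def Boundary.pre {d : ℕ} (γ : Boundary d) (n : ℕ) : Vertex d := List.ofFn fun i : Fin n => γ i

theorem Boundary.length_pre {d : ℕ} (γ : Boundary d) (n : ℕ) : (γ.pre n).length = n :=
  List.length_ofFn

theorem Boundary.getElem_pre {d : ℕ} (γ : Boundary d) (n i : ℕ) (h : i < (γ.pre n).length) :
    (γ.pre n)[i] = γ i := by
  simp [Boundary.pre]

theorem Boundary.pre_prefix {d : ℕ} (γ : Boundary d) {m n : ℕ} (h : m ≤ n) :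
    γ.pre m <+: γ.pre n := by
  rw [List.prefix_iff_eq_take]
  refine List.ext_getElem (by simp [Boundary.length_pre, h]) fun i h₁ h₂ => ?_
  rw [List.getElem_take, Boundary.getElem_pre, Boundary.getElem_pre]

/-- The action of `Aut(T_d)` on the boundary: the prefix of length `n` of `g • γ` is the image
under `g` of the prefix of length `n` of `γ`. -/
def boundaryAct {d : ℕ} (g : treeAut d) (γ : Boundary d) : Boundary d := fun n =>
  (g.1 (γ.pre (n + 1)))[n]'(by rw [g.2.1, Boundary.length_pre]; exact n.lt_succ_self)

theorem pre_boundaryAct {d : ℕ} (g : treeAut d) (γ : Boundary d) (n : ℕ) :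
    (boundaryAct g γ).pre n = g.1 (γ.pre n) := by
  refine List.ext_getElem (by rw [g.2.1, Boundary.length_pre, Boundary.length_pre])
    fun i h₁ h₂ => ?_
  rw [Boundary.getElem_pre]
  have hi : i + 1 ≤ n := by rwa [Boundary.length_pre] at h₁
  exact ((g.2.2 _ _).2 (γ.pre_prefix hi)).getElem _

theorem Boundary.ext_pre {d : ℕ} {γ η : Boundary d} (h : ∀ n, γ.pre n = η.pre n) : γ = η := by
  funext n
  have hn := γ.getElem_pre (n + 1) n (by rw [length_pre]; exact n.lt_succ_self)
  have hn' := η.getElem_pre (n + 1) n (by rw [length_pre]; exact n.lt_succ_self)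
  rw [← hn, ← hn']
  simp only [h]

instance (d : ℕ) : MulAction (treeAut d) (Boundary d) where
  smul := boundaryAct
  one_smul γ := Boundary.ext_pre fun n => pre_boundaryAct 1 γ n
  mul_smul g h γ := Boundary.ext_pre fun n => by
    refine (pre_boundaryAct (g * h) γ n).trans ?_
    refine Eq.trans ?_ (pre_boundaryAct g (boundaryAct h γ) n).symm
    rw [pre_boundaryAct]
    rfl

instance (d : ℕ) : ContinuousConstSMul (treeAut d) (Boundary d) where
  continuous_const_smul g := by
    refine continuous_pi fun n => IsLocallyConstant.continuous ?_
    have hpre : IsLocallyConstant fun γ : Boundary d => fun i : Fin (n + 1) => γ i :=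
      (IsLocallyConstant.iff_continuous _).2
        (continuous_pi fun i => continuous_apply (A := fun _ : ℕ => Fin d) (i : ℕ))
    refine (IsLocallyConstant.iff_exists_open _).2 fun γ => ?_
    obtain ⟨U, hU, hγ, h⟩ := (IsLocallyConstant.iff_exists_open _).1 hpre γ
    refine ⟨U, hU, hγ, fun η hη => ?_⟩
    have hp : η.pre (n + 1) = γ.pre (n + 1) := congrArg List.ofFn (h η hη)
    change (g.1 (η.pre (n + 1)))[n]'_ = (g.1 (γ.pre (n + 1)))[n]'_
    simp only [hp]

/-! ## The alternating mother group -/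

/-- The group `A`: alternating permutations of the first level, with trivial sections. -/
def setA (d : ℕ) : Set (treeAut d) := {g | ∃ σ ∈ alternatingGroup (Fin d), g = rooted σ}

/-- The group `B`: the elements with a wreath recursion `g = (g, σ_1, …, σ_{d-1}) ρ`, where all
`σ_i` and `ρ` are alternating permutations and `ρ` fixes the letter `0`. -/
def setB (d : ℕ) : Set (treeAut d) :=
  {g | ∃ σ : Fin d → Equiv.Perm (Fin d), ∃ ρ ∈ alternatingGroup (Fin d),
    (∀ x, σ x ∈ alternatingGroup (Fin d)) ∧ (∀ x : Fin d, x.val = 0 → ρ x = x) ∧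
    HasWreathRecursion g (fun x => if x.val = 0 then g else rooted (σ x)) ρ}

/-- The alternating mother group over `d` letters. -/
def motherGroup (d : ℕ) : Subgroup (treeAut d) := Subgroup.closure (setA d ∪ setB d)

instance (d : ℕ) : ContinuousConstSMul (motherGroup d) (Boundary d) where
  continuous_const_smul g := continuous_const_smul (g : treeAut d)

/-! ## The space of subgroups and stability systems -/

/-- The space `Sub(G)` of subgroups of `G`. -/
abbrev Sub (G : Type*) [Group G] : Type _ := Subgroup G

open Classical in
/-- The Chabauty topology: the topology induced by the product topology on `{0,1}^G`. -/
noncomputable instance (G : Type*) [Group G] : TopologicalSpace (Sub G) :=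
  TopologicalSpace.induced (fun (H : Subgroup G) (g : G) => decide (g ∈ H))
    (inferInstance : TopologicalSpace (G → Bool))

/-- The action of `G` on `Sub(G)` by conjugation. -/
instance (G : Type*) [Group G] : MulAction G (Sub G) where
  smul g H := (Subgroup.map (MulAut.conj g).toMonoidHom H : Subgroup G)
  one_smul H := by
    change Subgroup.map _ _ = _
    rw [map_one]
    exact Subgroup.map_id H
  mul_smul g h H := by
    change Subgroup.map _ _ = Subgroup.map _ (Subgroup.map _ _)
    rw [Subgroup.map_map]
    congr 1
    ext; simp

theorem mem_smul_sub {G : Type*} [Group G] (g : G) (H : Sub G) (k : G) :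
    k ∈ g • H ↔ g⁻¹ * k * g ∈ H := by
  change k ∈ Subgroup.map (MulAut.conj g).toMonoidHom H ↔ _
  rw [Subgroup.mem_map_equiv, MulAut.conj_symm_apply]

instance (G : Type*) [Group G] : ContinuousConstSMul G (Sub G) where
  continuous_const_smul g := by
    refine continuous_induced_rng.2 (continuous_pi fun k => ?_)
    have h : Continuous fun H : Sub G =>
        @decide (g⁻¹ * k * g ∈ H) (Classical.propDecidable _) :=
      (continuous_apply (g⁻¹ * k * g)).comp
        (continuous_induced_dom (f := fun (H : Sub G) (g : G) =>
          @decide (g ∈ H) (Classical.propDecidable _)))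
    refine h.congr fun H => ?_
    exact decide_eq_decide.2 (mem_smul_sub g H k).symm

/-- The stabiliser map `Y → Sub(G)`. -/
def stabMap (G Y : Type*) [Group G] [MulAction G Y] (y : Y) : Sub G := MulAction.stabilizer G y

theorem stabMap_smul (G Y : Type*) [Group G] [MulAction G Y] (g : G) (y : Y) :
    stabMap G Y (g • y) = g • stabMap G Y y :=
  MulAction.stabilizer_smul_eq_stabilizer_map_conj g y

/-- The stability system of an action `G ↷ Y`: the closure in `Sub(G)` of the stabilisers of the
points at which the stabiliser map is continuous. -/
def stabilitySystem (G Y : Type*) [Group G] [TopologicalSpace Y] [MulAction G Y] : Set (Sub G) :=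
  closure (stabMap G Y '' {y | ContinuousAt (stabMap G Y) y})

theorem smul_mem_stabilitySystem {G Y : Type*} [Group G] [TopologicalSpace Y] [MulAction G Y]
    [ContinuousConstSMul G Y] (g : G) {H : Sub G} (hH : H ∈ stabilitySystem G Y) :
    g • H ∈ stabilitySystem G Y := by
  refine map_mem_closure (continuous_const_smul g) hH ?_
  rintro _ ⟨y, hy, rfl⟩
  refine ⟨g • y, ?_, stabMap_smul G Y g y⟩
  have h : stabMap G Y = fun z => g • stabMap G Y (g⁻¹ • z) := by
    funext z
    rw [← stabMap_smul, smul_inv_smul]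
  change ContinuousAt (stabMap G Y) (g • y)
  rw [h]
  have hy' : ContinuousAt (stabMap G Y) (g⁻¹ • g • y) := by rwa [inv_smul_smul]
  exact ContinuousAt.comp (f := fun z => stabMap G Y (g⁻¹ • z))
    (continuous_const_smul g).continuousAt
    (ContinuousAt.comp (f := fun z : Y => g⁻¹ • z) hy' (continuous_const_smul g⁻¹).continuousAt)

/-- The action of `G` on a stability system, by conjugation. -/
instance (G Y : Type*) [Group G] [TopologicalSpace Y] [MulAction G Y] [ContinuousConstSMul G Y] :
    MulAction G (stabilitySystem G Y) where
  smul g H := ⟨g • H.1, smul_mem_stabilitySystem g H.2⟩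
  one_smul H := Subtype.ext (one_smul G H.1)
  mul_smul g h H := Subtype.ext (mul_smul g h H.1)

/-- The Schreier dynamical system of the mother group: the stability system of its action on the
boundary of the tree. -/
abbrev SchreierSystem (d : ℕ) : Type := stabilitySystem (motherGroup d) (Boundary d)

/-! ## Topological full groups -/

instance (G Y : Type*) [Group G] [TopologicalSpace Y] [MulAction G Y] [ContinuousConstSMul G Y] :
    ContinuousConstSMul G (stabilitySystem G Y) where
  continuous_const_smul g :=
    ((continuous_const_smul g).comp continuous_subtype_val).subtype_mk _

/-- The topological full group `[[G]]` of an action by homeomorphisms `G ↷ X`: the homeomorphisms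
of `X` that coincide, in a neighbourhood of every point, with the action of an element of `G`. -/
def topologicalFullGroup (G X : Type*) [Group G] [TopologicalSpace X] [MulAction G X]
    [ContinuousConstSMul G X] : Subgroup (X ≃ₜ X) where
  carrier := {h | ∀ x, ∃ g : G, ∀ᶠ y in 𝓝 x, h y = g • y}
  one_mem' x := ⟨1, Eventually.of_forall fun y => (one_smul G y).symm⟩
  mul_mem' := by
    intro h₁ h₂ H₁ H₂ x
    obtain ⟨g₂, hg₂⟩ := H₂ x
    obtain ⟨g₁, hg₁⟩ := H₁ (h₂ x)
    refine ⟨g₁ * g₂, ?_⟩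
    filter_upwards [hg₂, (h₂.continuous.tendsto x).eventually hg₁] with y hy hy'
    change h₁ (h₂ y) = _
    rw [hy', hy, mul_smul]
  inv_mem' := by
    intro h H x
    obtain ⟨g, hg⟩ := H (h.symm x)
    refine ⟨g⁻¹, ?_⟩
    filter_upwards [(h.symm.continuous.tendsto x).eventually hg] with y hy
    change h.symm y = _
    rw [h.apply_symm_apply] at hy
    rw [hy, inv_smul_smul, ← hy]

/-- The subgroup generated by the torsion elements. -/
def torsionGenerated (H : Type*) [Group H] : Subgroup H :=
  Subgroup.closure {h | IsOfFinOrder h}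

/-- The full group `[[M]]` of the mother group `M`, acting on its Schreier dynamical system. -/
noncomputable abbrev fullGroup (d : ℕ) : Subgroup (SchreierSystem d ≃ₜ SchreierSystem d) :=
  topologicalFullGroup (motherGroup d) (SchreierSystem d)

/-- `[[M]]_t`: the subgroup of `[[M]]` generated by its torsion elements. -/
noncomputable abbrev fullGroupT (d : ℕ) : Subgroup (fullGroup d) := torsionGenerated (fullGroup d)

end MotherGroup

namespace MotherGroup

open scoped commutatorElement Pointwise

/-! ## A criterion for finite generation -/

/-! Write Γ for the full group, T for the subgroup generated by its torsion, and N for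
`alternatingFull`, the normal subgroup generated by the elements t with t³ = 1 whose fixed-point set
is open. The theorem follows from two facts: torsion elements commute modulo N, and N lies in a
subgroup H generated by finitely many torsion elements. Indeed, then [H,H] ≤ [T,T] ≤ N ≤ H, the
abelianization of H is finite, and [T,T] has finite index in the finitely generated group H
(`fg_commutator_torsionGenerated`).

The first fact (`commutator_mem_of_isOfFinOrder`) needs only that N has infinite orbits. By B. H.
Neumann's covering lemma some element of N moves a finite orbit of a off a finite orbit of b.
Conjugating by it does nothing modulo N and gives small pieces of a and b disjoint supports;
compactness passes from pieces to a and b.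

The second fact uses self-similarity. The space X splits into d copies of itself, and M contains the
alternating permutations of the copies as well as a copy of M acting on one piece alone. Let `cyc U
σ` permute the copies by σ over the clopen set U. Since the alternating group is perfect for d ≥ 5,
and the commutator of `cyc U σ` and `cyc V τ` is `cyc (U ∩ V) ⁅σ, τ⁆`, the sets U for which H
contains all `cyc U σ` form an M-invariant algebra. Hence finitely many U suffice as soon as the
algebra of clopen sets is finitely generated under M; here the fixed-point sets of the finite group
B generate it, because M is contracting (`fixSet_mem`). Finally each generator of N is locally
conjugate in H to some `cyc U σ`, after its three points have been moved to different copies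
(`alternatingFull_le`). -/

theorem finite_abelianization {H : Type*} [Group H] {S : Set H} (hS : S.Finite)
    (hS' : ∀ s ∈ S, IsOfFinOrder s) (hc : Subgroup.closure S = ⊤) : Finite (Abelianization H) := by
  have hc' : Subgroup.closure (Abelianization.of '' S) = ⊤ := by
    rw [← MonoidHom.map_closure, hc, ← MonoidHom.range_eq_map, MonoidHom.range_eq_top]
    exact QuotientGroup.mk_surjective
  have hfg : Group.FG (Abelianization H) :=
    Group.fg_iff.2 ⟨_, hc', hS.image _⟩
  refine CommGroup.finite_of_fg_isMulTorsion _ fun x => ?_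
  have hx : x ∈ Subgroup.closure (Abelianization.of '' S) := hc' ▸ Subgroup.mem_top x
  have hle : Subgroup.closure (Abelianization.of '' S) ≤
      CommGroup.torsion (Abelianization H) := by
    rw [Subgroup.closure_le]
    rintro _ ⟨s, hs, rfl⟩
    exact MonoidHom.isOfFinOrder _ (hS' s hs)
  exact hle hx

/-- In the quotient by `N` the elements of `T` commute pairwise. Centralizers are subgroups, so
commutation extends to the closure in one argument and then in the other. -/
theorem commutator_closure_le {Γ : Type*} [Group Γ] {N : Subgroup Γ} [N.Normal] {T : Set Γ}
    (h : ∀ a ∈ T, ∀ b ∈ T, ⁅a, b⁆ ∈ N) :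
    ⁅Subgroup.closure T, Subgroup.closure T⁆ ≤ N := by
  have key : ∀ a ∈ T, ∀ b ∈ Subgroup.closure T, ⁅a, b⁆ ∈ N := by
    intro a ha
    have : Subgroup.closure T ≤
        (Subgroup.centralizer {(QuotientGroup.mk' N a)}).comap (QuotientGroup.mk' N) := by
      rw [Subgroup.closure_le]
      intro b hb
      have := (QuotientGroup.eq_one_iff _).2 (h a ha b hb)
      change QuotientGroup.mk' N _ = 1 at this
      rw [map_commutatorElement, commutatorElement_eq_one_iff_mul_comm] at this
      simpa [Subgroup.mem_centralizer_iff] using this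
    intro b hb
    have hb := this hb
    rw [← QuotientGroup.eq_one_iff]
    change QuotientGroup.mk' N _ = 1
    rw [map_commutatorElement, commutatorElement_eq_one_iff_mul_comm]
    simpa [Subgroup.mem_centralizer_iff] using hb
  rw [Subgroup.commutator_le]
  intro a ha b hb
  have : Subgroup.closure T ≤
      (Subgroup.centralizer {(QuotientGroup.mk' N b)}).comap (QuotientGroup.mk' N) := by
    rw [Subgroup.closure_le]
    intro a ha
    have := (QuotientGroup.eq_one_iff _).2 (key a ha b hb)
    change QuotientGroup.mk' N _ = 1 at this
    rw [map_commutatorElement, commutatorElement_eq_one_iff_mul_comm] at this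
    simpa [Subgroup.mem_centralizer_iff] using this.symm
  replace ha := this ha
  rw [← QuotientGroup.eq_one_iff]
  change QuotientGroup.mk' N _ = 1
  rw [map_commutatorElement, commutatorElement_eq_one_iff_mul_comm]
  exact ((Subgroup.mem_centralizer_iff.1 (Subgroup.mem_comap.1 ha)) _ rfl).symm

/-- If the commutators of torsion elements lie in a normal subgroup `N`, and `N` lies in a subgroup
generated by finitely many torsion elements, then the derived subgroup of the subgroup generated by
the torsion elements is finitely generated. -/
theorem fg_commutator_torsionGenerated {Γ : Type*} [Group Γ] {S : Set Γ} (hS : S.Finite)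
    (hS' : ∀ s ∈ S, IsOfFinOrder s) {N : Subgroup Γ} [N.Normal] (hN : N ≤ Subgroup.closure S)
    (hcomm : ∀ a b : Γ, IsOfFinOrder a → IsOfFinOrder b → ⁅a, b⁆ ∈ N) :
    Group.FG (commutator (torsionGenerated Γ)) := by
  set H := Subgroup.closure S with hH
  set C : Subgroup Γ := ⁅torsionGenerated Γ, torsionGenerated Γ⁆ with hC
  have hCH : C ≤ H := (commutator_closure_le fun a ha b hb => hcomm a b ha hb).trans hN
  have hHT : H ≤ torsionGenerated Γ := Subgroup.closure_mono hS'
  have hfgH : Group.FG H := (Group.fg_iff_subgroup_fg H).2 ⟨hS.toFinset, by simp [hH]⟩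
  have hfin : Finite (Abelianization H) := by
    refine finite_abelianization (S := (fun x : H => (x : Γ)) ⁻¹' S)
      (hS.preimage Subtype.val_injective.injOn) ?_ ?_
    · intro s hs
      exact Submonoid.isOfFinOrder_coe.1 (hS' s hs)
    · exact Subgroup.closure_closure_coe_preimage
  have hind : (commutator H).index ≠ 0 := by
    rw [Subgroup.index]
    have : Finite (H ⧸ commutator H) := hfin
    exact Nat.card_pos.ne'
  have hle : commutator H ≤ C.subgroupOf H := by
    have : (commutator H).map H.subtype ≤ C := by
      rw [Subgroup.map_subtype_commutator]
      exact Subgroup.commutator_mono hHT hHT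
    rwa [Subgroup.subgroupOf, ← Subgroup.map_le_iff_le_comap]
  have hind' : (C.subgroupOf H).index ≠ 0 := fun h0 =>
    hind (Nat.eq_zero_of_zero_dvd (h0 ▸ Subgroup.index_dvd_of_le hle))
  have : (C.subgroupOf H).FiniteIndex := ⟨hind'⟩
  -- Schreier's lemma: a finite-index subgroup of a finitely generated group is finitely generated.
  have hfg : Group.FG (C.subgroupOf H) :=  inferInstance
  have hfgC : Group.FG C :=
    Group.fg_of_surjective (f := (Subgroup.subgroupOfEquivOfLe hCH).toMonoidHom)
      (Subgroup.subgroupOfEquivOfLe hCH).surjective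
  have e : commutator (torsionGenerated Γ) ≃* C :=
    (Subgroup.equivMapOfInjective _ (torsionGenerated Γ).subtype
      (Subgroup.subtype_injective _)).trans
      (MulEquiv.subgroupCongr (Subgroup.map_subtype_commutator _))
  exact Group.fg_of_surjective (f := e.symm.toMonoidHom) e.symm.surjective

/-- A form of the coset covering lemma: finite sets of points with infinite orbits can
be moved apart. -/
theorem exists_smul_notMem {Γ X : Type*} [Group Γ] [MulAction Γ X] {P Q : Set X} (hP : P.Finite)
    (hQ : Q.Finite) (horb : ∀ p ∈ P, (MulAction.orbit Γ p).Infinite) :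
    ∃ f : Γ, ∀ p ∈ P, f • p ∉ Q := by
  classical
  by_contra! hcon
  choose p hp hpQ using hcon
  -- If no `f` works, every `f` sends some `p ∈ P` to some `q ∈ Q`. The elements sending `p` to `q`
  -- form a left coset of the stabiliser of `p`, so finitely many such cosets cover the group, and
  -- one of the stabilisers has finite index. The value `1` of `g` is never used on `s`.
  let s : Finset (X × X) := (hP.toFinset ×ˢ hQ.toFinset).filter fun z => ∃ f : Γ, f • z.1 = z.2
  let g : X × X → Γ := fun z => if h : ∃ f : Γ, f • z.1 = z.2 then h.choose else 1
  have hcov : ⋃ z ∈ s, g z • (MulAction.stabilizer Γ z.1 : Set Γ) = Set.univ := by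
    refine Set.eq_univ_of_forall fun f => ?_
    have hex : ∃ f' : Γ, f' • p f = f • p f := ⟨f, rfl⟩
    simp only [Set.mem_iUnion]
    refine ⟨(p f, f • p f), ?_, ?_⟩
    · simp only [s, Finset.mem_filter, Finset.mem_product, Set.Finite.mem_toFinset]
      exact ⟨⟨hp f, hpQ f⟩, hex⟩
    · rw [mem_leftCoset_iff]
      simp only [g, dif_pos hex, SetLike.mem_coe, MulAction.mem_stabilizer_iff, mul_smul]
      rw [inv_smul_eq_iff, hex.choose_spec]
  obtain ⟨z, hz, hfi⟩ := Subgroup.exists_finiteIndex_of_leftCoset_cover hcov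
  have hz1 : z.1 ∈ P := by
    simp only [s, Finset.mem_filter, Finset.mem_product, Set.Finite.mem_toFinset] at hz
    exact hz.1.1
  have : Finite (Γ ⧸ MulAction.stabilizer Γ z.1) := Subgroup.finite_quotient_of_finiteIndex
  exact horb _ hz1 (@Set.toFinite _ _ (Finite.of_equiv _
    (MulAction.orbitEquivQuotientStabilizer Γ z.1).symm))

/-! ## Restrictions of elements of a full group to invariant clopen sets -/

section Invariant

variable {Γ X : Type*} [Group Γ] [MulAction Γ X]

/-- A set is invariant under a permutation. -/
def IsInvariant (f : Γ) (V : Set X) : Prop :=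
  ∀ x, f • x ∈ V ↔ x ∈ V

theorem IsInvariant.inv {f : Γ} {V : Set X}
    (h : IsInvariant f V) : IsInvariant f⁻¹ V := fun x => by
  rw [← h, smul_inv_smul]

theorem IsInvariant.inter {f : Γ} {V W : Set X}
    (h : IsInvariant f V) (h' : IsInvariant f W) : IsInvariant f (V ∩ W) := fun x =>
  and_congr (h x) (h' x)

theorem IsInvariant.compl {f : Γ} {V : Set X}
    (h : IsInvariant f V) : IsInvariant f Vᶜ := fun x => not_congr (h x)

theorem IsInvariant.union {f : Γ} {V W : Set X}
    (h : IsInvariant f V) (h' : IsInvariant f W) : IsInvariant f (V ∪ W) := fun x =>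
  or_congr (h x) (h' x)

end Invariant

section FullGroup

variable {G X : Type*} [Group G] [TopologicalSpace X] [MulAction G X] [ContinuousConstSMul G X]

instance : MulAction (topologicalFullGroup G X) X where
  smul f x := f.1 x
  one_smul _ := rfl
  mul_smul _ _ _ := rfl

instance : ContinuousConstSMul (topologicalFullGroup G X) X where
  continuous_const_smul f := f.1.continuous

theorem fullGroup_ext {f g : topologicalFullGroup G X} (h : ∀ x : X, f • x = g • x) : f = g :=
  Subtype.ext (Homeomorph.ext h)

theorem exists_eventually_smul_eq (f : topologicalFullGroup G X) (x : X) :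
    ∃ g : G, ∀ᶠ y in 𝓝 x, f • y = g • y := f.2 x

variable (X) in
/-- The elements of `G` as elements of the full group. -/
def toFull : G →* topologicalFullGroup G X where
  toFun g := ⟨Homeomorph.smul g, fun _ => ⟨g, Eventually.of_forall fun _ => rfl⟩⟩
  map_one' := fullGroup_ext fun x => one_smul G x
  map_mul' g h := fullGroup_ext fun x => mul_smul g h x

theorem toFull_smul (g : G) (x : X) : toFull X g • x = g • x := rfl

open Classical in
/-- The restriction of an element of the full group to an invariant clopen set. -/
noncomputable def restr (f : topologicalFullGroup G X) (V : Set X) (hV : IsClopen V)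
    (hf : IsInvariant f V) : topologicalFullGroup G X where
  val :=
    { toFun := fun x => if x ∈ V then f • x else x
      invFun := fun x => if x ∈ V then f⁻¹ • x else x
      left_inv := fun x => by
        by_cases h : x ∈ V
        · simp only [h, if_true, (hf x).2 h, inv_smul_smul]
        · simp only [h, if_false]
      right_inv := fun x => by
        by_cases h : x ∈ V
        · simp only [h, if_true, (hf.inv x).2 h, smul_inv_smul]
        · simp only [h, if_false]
      continuous_toFun := Continuous.if (by simp [hV.frontier_eq]) (continuous_const_smul f)
        continuous_id
      continuous_invFun := Continuous.if (by simp [hV.frontier_eq]) (continuous_const_smul f⁻¹)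
        continuous_id }
  property := fun x => by
    by_cases h : x ∈ V
    · obtain ⟨g, hg⟩ := exists_eventually_smul_eq f x
      refine ⟨g, ?_⟩
      filter_upwards [hg, hV.isOpen.mem_nhds h] with y hy hyV
      change (if y ∈ V then f • y else y) = _
      rw [if_pos hyV, hy]
    · refine ⟨1, ?_⟩
      filter_upwards [hV.compl.isOpen.mem_nhds h] with y hyV
      change (if y ∈ V then f • y else y) = _
      rw [if_neg hyV, one_smul]

variable {f : topologicalFullGroup G X} {V : Set X} {hV : IsClopen V} {hf : IsInvariant f V}

theorem restr_smul_of_mem {x : X} (h : x ∈ V) : restr f V hV hf • x = f • x := if_pos h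

theorem restr_smul_of_notMem {x : X} (h : x ∉ V) : restr f V hV hf • x = x := if_neg h

theorem isInvariant_univ (f : topologicalFullGroup G X) : IsInvariant f (Set.univ : Set X) :=
  fun _ => Iff.rfl

theorem restr_univ (f : topologicalFullGroup G X) :
    restr f Set.univ isClopen_univ (isInvariant_univ f) = f :=
  fullGroup_ext fun x => restr_smul_of_mem (Set.mem_univ x)

theorem restr_eq_one (h : ∀ x ∈ V, f • x = x) : restr f V hV hf = 1 :=
  fullGroup_ext fun x => by
    by_cases hx : x ∈ V
    · rw [restr_smul_of_mem hx, h x hx, one_smul]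
    · rw [restr_smul_of_notMem hx, one_smul]

theorem restr_eq_mul {S : Set X} (hS : IsClopen S) (hfS : IsInvariant f S) :
    restr f V hV hf = restr f (V ∩ S) (hV.inter hS) (hf.inter hfS) *
      restr f (V ∩ Sᶜ) (hV.inter hS.compl) (hf.inter hfS.compl) :=
  fullGroup_ext fun x => by
    rw [mul_smul]
    by_cases hx : x ∈ V
    · rw [restr_smul_of_mem hx]
      by_cases hxS : x ∈ S
      · rw [restr_smul_of_notMem (V := V ∩ Sᶜ) (fun h => h.2 hxS), restr_smul_of_mem (V := V ∩ S) ⟨hx, hxS⟩]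
      · rw [restr_smul_of_mem (V := V ∩ Sᶜ) ⟨hx, hxS⟩,
          restr_smul_of_notMem fun h => hxS ((hfS x).1 h.2)]
    · rw [restr_smul_of_notMem hx, restr_smul_of_notMem (V := V ∩ Sᶜ) (fun h => hx h.1),
        restr_smul_of_notMem fun h => hx h.1]

theorem isInvariant_conj {h : topologicalFullGroup G X} (hf : IsInvariant f V) :
    IsInvariant (h * f * h⁻¹) ((h⁻¹ • · : X → X) ⁻¹' V) := fun x => by
  simp only [Set.mem_preimage, mul_smul, inv_smul_smul]
  exact hf _

theorem restr_conj (h : topologicalFullGroup G X) (hc : IsClopen ((h⁻¹ • · : X → X) ⁻¹' V)) :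
    restr (h * f * h⁻¹) ((h⁻¹ • · : X → X) ⁻¹' V) hc (isInvariant_conj hf) = h * restr f V hV hf * h⁻¹ :=
  fullGroup_ext fun x => by
    rw [mul_smul, mul_smul]
    by_cases hx : h⁻¹ • x ∈ V
    · rw [restr_smul_of_mem hx, restr_smul_of_mem (V := (h⁻¹ • · : X → X) ⁻¹' V) hx, mul_smul, mul_smul]
    · rw [restr_smul_of_notMem hx, restr_smul_of_notMem (V := (h⁻¹ • · : X → X) ⁻¹' V) hx, smul_inv_smul]

/-- Orbits of torsion elements have small invariant clopen neighbourhoods. -/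
theorem exists_isClopen_isInvariant [CompactSpace X] [T2Space X] [TotallyDisconnectedSpace X]
    (hfin : IsOfFinOrder f) {O : Set X} (hO : IsOpen O) {x : X} (hx : ∀ k : ℕ, f ^ k • x ∈ O) :
    ∃ S, IsClopen S ∧ IsInvariant f S ∧ x ∈ S ∧ S ⊆ O := by
  obtain ⟨n, hn, h1⟩ := isOfFinOrder_iff_pow_eq_one.1 hfin
  have hmod : ∀ k, f ^ k = f ^ (k % n) := fun k => by
    conv_lhs => rw [← Nat.mod_add_div k n, pow_add, pow_mul, h1, one_pow, mul_one]
  -- Points of `O'` have their whole orbit in `O`, so the saturation of a clopen set inside `O'`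
  -- stays in `O`.
  let O' : Set X := ⋂ k ∈ Finset.range n, (f ^ k • · : X → X) ⁻¹' O
  have hO' : IsOpen O' := isOpen_biInter_finset fun k _ => hO.preimage (continuous_const_smul _)
  have hxO' : x ∈ O' := by
    simp only [O', Set.mem_iInter]
    exact fun k _ => hx k
  have hmem : ∀ y ∈ O', ∀ k : ℕ, f ^ k • y ∈ O := fun y hy k => by
    rw [hmod]
    simp only [O', Set.mem_iInter] at hy
    exact hy _ (Finset.mem_range.2 (Nat.mod_lt _ hn))
  obtain ⟨U, hU, hxU, hUO⟩ := compact_exists_isClopen_in_isOpen hO' hxO'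
  refine ⟨⋃ k ∈ Finset.range n, (f ^ k • · : X → X) ⁻¹' U, ?_, ?_, ?_, ?_⟩
  · exact Set.Finite.isClopen_biUnion (Finset.finite_toSet _)
      fun k _ => hU.preimage (continuous_const_smul _)
  · have hiff : ∀ y, y ∈ ⋃ k ∈ Finset.range n, (f ^ k • · : X → X) ⁻¹' U ↔
        ∃ k : ℕ, f ^ k • y ∈ U := fun y => by
      simp only [Set.mem_iUnion, Set.mem_preimage, Finset.mem_range]
      refine ⟨fun ⟨k, _, hk⟩ => ⟨k, hk⟩, fun ⟨k, hk⟩ => ⟨k % n, Nat.mod_lt _ hn, ?_⟩⟩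
      rwa [← hmod]
    intro y
    rw [hiff, hiff]
    constructor
    · rintro ⟨k, hk⟩
      exact ⟨k + 1, by rwa [pow_succ, mul_smul]⟩
    · rintro ⟨k, hk⟩
      -- The exponent `k - 1`, taken modulo `n` to avoid subtraction below zero.
      refine ⟨k + (n - 1), ?_⟩
      rw [← mul_smul, ← pow_succ, add_assoc, Nat.sub_add_cancel hn, pow_add, h1, mul_one]
      exact hk
  · simp only [Set.mem_iUnion]
    exact ⟨0, Finset.mem_range.2 hn, by simpa using hxU⟩
  · intro y hy
    simp only [Set.mem_iUnion, Set.mem_preimage, Finset.mem_range] at hy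
    obtain ⟨k, hk, hy⟩ := hy
    have := hmem _ (hUO hy) (n - k)
    rwa [← mul_smul, ← pow_add, Nat.sub_add_cancel hk.le, h1, one_smul] at this

/-- A local-to-global principle: an element of the full group belongs to one of the members of a
directed family of subgroups when its restrictions to small invariant clopen sets do. -/
theorem exists_mem_of_forall_restr_mem [CompactSpace X] {ι : Type*} [Nonempty ι]
    (K : ι → Subgroup (topologicalFullGroup G X)) (hK : Directed (· ≤ ·) K)
    (h : ∀ x, ∃ i, ∃ S ∈ 𝓝 x, IsClopen S ∧ IsInvariant f S ∧
      ∀ V hV hf, V ⊆ S → restr f V hV hf ∈ K i) : ∃ i, f ∈ K i := by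
  have key : ∃ i S, IsClopen S ∧ IsInvariant f S ∧ Set.univ ⊆ S ∧
      ∀ V hV hf, V ⊆ S → restr f V hV hf ∈ K i := by
    -- The condition passes to unions: `restr_eq_mul` cuts a restriction into a part inside `S` and
    -- a part inside `S'`, and directedness provides one subgroup containing both.
    refine (isCompact_univ (X := X)).induction_on (p := fun T => ∃ i S, IsClopen S ∧
      IsInvariant f S ∧ T ⊆ S ∧ ∀ V hV hf, V ⊆ S → restr f V hV hf ∈ K i) ?_ ?_ ?_ ?_
    · refine ⟨Classical.arbitrary ι, ∅, isClopen_empty, fun x => Iff.rfl, subset_rfl,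
        fun V hV hf hVS => ?_⟩
      rw [restr_eq_one fun x hx => (hVS hx).elim]
      exact one_mem _
    · rintro s t hst ⟨i, S, h1, h2, h3, h4⟩
      exact ⟨i, S, h1, h2, hst.trans h3, h4⟩
    · rintro s t ⟨i, S, h1, h2, h3, h4⟩ ⟨j, S', h1', h2', h3', h4'⟩
      obtain ⟨k, hik, hjk⟩ := hK i j
      refine ⟨k, S ∪ S', h1.union h1', h2.union h2', Set.union_subset_union h3 h3',
        fun V hV hf hVS => ?_⟩
      rw [restr_eq_mul h1 h2]
      refine mul_mem (hik (h4 _ _ _ Set.inter_subset_right)) (hjk (h4' _ _ _ ?_))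
      rintro x ⟨hx, hxS⟩
      exact (hVS hx).resolve_left hxS
    · intro x _
      obtain ⟨i, S, h0, h1, h2, h3⟩ := h x
      exact ⟨S, mem_nhdsWithin_of_mem_nhds h0, i, S, h1, h2, subset_rfl, h3⟩
  obtain ⟨i, S, h1, h2, h3, h4⟩ := key
  refine ⟨i, ?_⟩
  rw [← restr_univ f]
  exact h4 _ _ _ h3

theorem mem_of_forall_restr_mem [CompactSpace X] (K : Subgroup (topologicalFullGroup G X))
    (h : ∀ x, ∃ S ∈ 𝓝 x, IsClopen S ∧ IsInvariant f S ∧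
      ∀ V hV hf, V ⊆ S → restr f V hV hf ∈ K) : f ∈ K := by
  obtain ⟨_, hf⟩ := exists_mem_of_forall_restr_mem (ι := Unit) (fun _ => K)
    (fun _ _ => ⟨(), le_rfl, le_rfl⟩) fun x => ⟨(), h x⟩
  exact hf

/-- Torsion elements of the full group commute modulo a normal subgroup with infinite orbits. -/
theorem commutator_mem_of_isOfFinOrder [CompactSpace X] [T2Space X] [TotallyDisconnectedSpace X]
    {N : Subgroup (topologicalFullGroup G X)} [N.Normal]
    (horb : ∀ x : X, (MulAction.orbit N x).Infinite) {a b : topologicalFullGroup G X}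
    (ha : IsOfFinOrder a) (hb : IsOfFinOrder b) : ⁅a, b⁆ ∈ N := by
  let π := QuotientGroup.mk' N
  have finite_orbit : ∀ {f : topologicalFullGroup G X}, IsOfFinOrder f → ∀ x : X,
      (Set.range fun k : ℕ => f ^ k • x).Finite := by
    intro f hf x
    have : (Set.range fun k : ℕ => f ^ k).Finite := by
      have h := hf.finite_powers
      rwa [Submonoid.coe_powers] at h
    have := this.image (· • x)
    rwa [← Set.range_comp] at this
  -- small restrictions commute
  have hloc : ∀ x y : X, ∃ S ∈ 𝓝 x, IsClopen S ∧ IsInvariant a S ∧ ∃ T ∈ 𝓝 y, IsClopen T ∧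
      IsInvariant b T ∧ ∀ V hV hf, V ⊆ S → ∀ W hW hf', W ⊆ T →
        Commute (π (restr a V hV hf)) (π (restr b W hW hf')) := by
    intro x y
    have hP := finite_orbit ha x
    have hQ := finite_orbit hb y
    obtain ⟨f, hf⟩ := exists_smul_notMem (Γ := N) hP hQ fun p _ => horb p
    have hfP : ((fun p : X => f • p) '' Set.range fun k : ℕ => a ^ k • x).Finite := hP.image _
    obtain ⟨O₁, O₂, hO₁, hO₂, hPO, hQO, hdisj⟩ : SeparatedNhds _ _ :=
      SeparatedNhds.of_isCompact_isCompact hfP.isCompact hQ.isCompact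
        (Set.disjoint_left.2 (by rintro _ ⟨p, hp, rfl⟩ hq; exact hf p hp hq))
    obtain ⟨S, hS, haS, hxS, hSO⟩ := exists_isClopen_isInvariant ha
      (hO₁.preimage (continuous_const_smul f.1)) (x := x)
      fun k => hPO ⟨_, ⟨k, rfl⟩, rfl⟩
    obtain ⟨T, hT, hbT, hyT, hTO⟩ := exists_isClopen_isInvariant hb hO₂ (x := y)
      fun k => hQO ⟨k, rfl⟩
    refine ⟨S, hS.isOpen.mem_nhds hxS, hS, haS, T, hT.isOpen.mem_nhds hyT, hT, hbT, ?_⟩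
    intro V hV hfV hVS W hW hfW hWT
    -- As `f` dies in the quotient, the piece of `a` may be replaced by its conjugate by `f`, whose
    -- support is disjoint from that of the piece of `b`.
    have hπ : π f.1 = 1 := (QuotientGroup.eq_one_iff _).2 f.2
    have hconj : π (restr a V hV hfV) = π (f.1 * restr a V hV hfV * f.1⁻¹) := by
      rw [map_mul, map_mul, map_inv, hπ, inv_one, one_mul, mul_one]
    rw [hconj]
    have hd : ∀ z, f.1⁻¹ • z ∈ V → z ∉ W := fun z hz hzW => by
      have h1 := hSO (hVS hz)
      rw [Set.mem_preimage, smul_inv_smul] at h1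
      exact Set.disjoint_left.1 hdisj h1 (hTO (hWT hzW))
    refine Commute.map ?_ π
    refine fullGroup_ext fun z => ?_
    simp only [mul_smul]
    by_cases hz : f.1⁻¹ • z ∈ V
    · rw [restr_smul_of_notMem (hd z hz), restr_smul_of_mem hz,
        restr_smul_of_notMem (hd _ (by rwa [inv_smul_smul, hfV]))]
    · rw [restr_smul_of_notMem hz, smul_inv_smul]
      by_cases hzW : z ∈ W
      · rw [restr_smul_of_mem hzW, restr_smul_of_notMem, smul_inv_smul]
        exact fun h => hd _ h ((hfW z).2 hzW)
      · rw [restr_smul_of_notMem hzW, restr_smul_of_notMem hz, smul_inv_smul]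
  have hcomm : Commute (π a) (π b) := by
    have hmem : a ∈ (Subgroup.centralizer {π b}).comap π := by
      refine mem_of_forall_restr_mem _ fun x => ?_
      -- The neighbourhood of `x` supplied by `hloc` depends on `y`. Shrinking it enlarges the
      -- centralizer, so these subgroups are directed and compactness in `y` gives one neighbourhood
      -- that serves all of `b`.
      let ι := {S : Set X // S ∈ 𝓝 x ∧ IsClopen S ∧ IsInvariant a S}
      let K : ι → Subgroup (topologicalFullGroup G X) := fun S =>
        (Subgroup.centralizer {z | ∃ V hV hf, V ⊆ S.1 ∧ z = π (restr a V hV hf)}).comap π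
      have : Nonempty ι := ⟨⟨Set.univ, univ_mem, isClopen_univ, isInvariant_univ a⟩⟩
      obtain ⟨⟨S, hS, hS', haS⟩, hb⟩ := exists_mem_of_forall_restr_mem (f := b) K
        (fun S T => ⟨⟨S.1 ∩ T.1, inter_mem S.2.1 T.2.1, S.2.2.1.inter T.2.2.1,
          S.2.2.2.inter T.2.2.2⟩,
          Subgroup.comap_mono (Subgroup.centralizer_le
            fun z ⟨V, hV, hf, hVS, hz⟩ => ⟨V, hV, hf, hVS.trans Set.inter_subset_left, hz⟩),
          Subgroup.comap_mono (Subgroup.centralizer_le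
            fun z ⟨V, hV, hf, hVS, hz⟩ => ⟨V, hV, hf, hVS.trans Set.inter_subset_right, hz⟩)⟩)
        (by
          intro y
          obtain ⟨S, h1, h2, h3, T, h4, h5, h6, h7⟩ := hloc x y
          refine ⟨⟨S, h1, h2, h3⟩, T, h4, h5, h6, fun W hW hf' hWT => ?_⟩
          rw [Subgroup.mem_comap, Subgroup.mem_centralizer_iff]
          rintro _ ⟨V, hV, hf, hVS, rfl⟩
          exact h7 V hV hf hVS W hW hf' hWT)
      refine ⟨S, hS, hS', haS, fun V hV hf hVS => ?_⟩
      rw [Subgroup.mem_comap, Subgroup.mem_centralizer_iff] at hb ⊢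
      rintro _ rfl
      exact (hb _ ⟨V, hV, hf, hVS, rfl⟩).symm
    rw [Subgroup.mem_comap, Subgroup.mem_centralizer_iff] at hmem
    exact (hmem _ rfl).symm
  rw [← QuotientGroup.eq_one_iff]
  change π _ = 1
  rw [map_commutatorElement, commutatorElement_eq_one_iff_mul_comm]
  exact hcomm

end FullGroup

/-! ## Self-similar actions -/

/-- The three-cycle of three letters. -/
theorem exists_threeCycle {d : ℕ} {i j k : Fin d} (hij : i ≠ j) (hik : i ≠ k) (hjk : j ≠ k) :
    ∃ σ : alternatingGroup (Fin d), σ ^ 3 = 1 ∧ σ.1 i = j ∧ σ.1 j = k ∧ σ.1 k = i ∧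
      ∀ l, l ≠ i → l ≠ j → l ≠ k → σ.1 l = l := by
  have h1 : (Equiv.swap i j * Equiv.swap j k) i = j := by
    rw [Equiv.Perm.mul_apply, Equiv.swap_apply_of_ne_of_ne hij hik, Equiv.swap_apply_left]
  have h2 : (Equiv.swap i j * Equiv.swap j k) j = k := by
    rw [Equiv.Perm.mul_apply, Equiv.swap_apply_left, Equiv.swap_apply_of_ne_of_ne hik.symm hjk.symm]
  have h3 : (Equiv.swap i j * Equiv.swap j k) k = i := by
    rw [Equiv.Perm.mul_apply, Equiv.swap_apply_right, Equiv.swap_apply_right]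
  have h4 : ∀ l, l ≠ i → l ≠ j → l ≠ k → (Equiv.swap i j * Equiv.swap j k) l = l := by
    intro l hi hj hk
    rw [Equiv.Perm.mul_apply, Equiv.swap_apply_of_ne_of_ne hj hk,
      Equiv.swap_apply_of_ne_of_ne hi hj]
  refine ⟨⟨Equiv.swap i j * Equiv.swap j k, ?_⟩, ?_, h1, h2, h3, h4⟩
  · rw [Equiv.Perm.mem_alternatingGroup, Equiv.Perm.sign_mul, Equiv.Perm.sign_swap hij,
      Equiv.Perm.sign_swap hjk]
    rfl
  · refine Subtype.ext (Equiv.ext fun l => ?_)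
    change (Equiv.swap i j * Equiv.swap j k) ((Equiv.swap i j * Equiv.swap j k)
      ((Equiv.swap i j * Equiv.swap j k) l)) = l
    by_cases hi : l = i
    · rw [hi, h1, h2, h3]
    by_cases hj : l = j
    · rw [hj, h2, h3, h1]
    by_cases hk : l = k
    · rw [hk, h3, h1, h2]
    rw [h4 l hi hj hk, h4 l hi hj hk, h4 l hi hj hk]

theorem exists_two_notMem {d : ℕ} {s : Finset (Fin d)} (hs : s.card + 2 ≤ d) :
    ∃ k ∉ s, ∃ l ∉ s, k ≠ l := by
  have h : 1 < sᶜ.card := by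
    rw [Finset.card_compl, Fintype.card_fin]
    omega
  obtain ⟨k, hk, l, hl, hkl⟩ := Finset.one_lt_card.1 h
  exact ⟨k, Finset.mem_compl.1 hk, l, Finset.mem_compl.1 hl, hkl⟩

theorem exists_two_ne {d : ℕ} (hd : 5 ≤ d) (i j l : Fin d) :
    ∃ k m : Fin d, (k ≠ i ∧ k ≠ j ∧ k ≠ l) ∧ (m ≠ i ∧ m ≠ j ∧ m ≠ l) ∧ k ≠ m := by
  obtain ⟨k, hk, m, hm, hkm⟩ := exists_two_notMem (s := {i, j, l})
    ((Nat.add_le_add_right Finset.card_le_three 2).trans hd)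
  simp only [Finset.mem_insert, Finset.mem_singleton, not_or] at hk hm
  exact ⟨k, m, hk, hm, hkm⟩

/-- An action of `G` on `X` is self-similar over `d` letters if `X` is identified with `d` copies of
itself so that the elements of `G` act by permuting the copies followed by elements of `G` inside
of each copy, and `G` contains all alternating permutations of the copies and the copies of `G`
acting on one piece. -/
structure SelfSimilarity (G X : Type*) [Group G] [TopologicalSpace X] [MulAction G X]
    (d : ℕ) where
  /-- the identification of `X` with `d` copies of itself -/
  toHomeo : Fin d × X ≃ₜ X
  /-- the action on the copies -/
  perm : G → Equiv.Perm (Fin d)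
  /-- the sections -/
  sec : G → Fin d → G
  smul_apply : ∀ g i x, g • toHomeo (i, x) = toHomeo (perm g i, sec g i • x)
  /-- the element acting on one copy -/
  loc : Fin d → G → G
  loc_smul : ∀ i g j x, loc i g • toHomeo (j, x) = toHomeo (j, if j = i then g • x else x)
  /-- the alternating permutations of the copies -/
  root : alternatingGroup (Fin d) → G
  root_smul : ∀ σ j x, root σ • toHomeo (j, x) = toHomeo (σ.1 j, x)

/-- An algebra of subsets of `X` that is invariant under `G`. -/
structure IsInvariantAlgebra (G : Type*) {X : Type*} [Group G] [MulAction G X]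
    (A : Set (Set X)) : Prop where
  univ_mem : Set.univ ∈ A
  compl_mem : ∀ U ∈ A, Uᶜ ∈ A
  inter_mem : ∀ U ∈ A, ∀ V ∈ A, U ∩ V ∈ A
  smul_mem : ∀ (g : G), ∀ U ∈ A, (g • · : X → X) ⁻¹' U ∈ A

namespace SelfSimilarity

variable {G X : Type*} [Group G] [TopologicalSpace X] [MulAction G X] {d : ℕ}
  (S : SelfSimilarity G X d)

theorem exists_eq (x : X) : ∃ j u, x = S.toHomeo (j, u) :=
  ⟨(S.toHomeo.symm x).1, (S.toHomeo.symm x).2, by simp⟩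

theorem apply_inj {i j : Fin d} {u v : X} :
    S.toHomeo (i, u) = S.toHomeo (j, v) ↔ i = j ∧ u = v := by
  rw [S.toHomeo.injective.eq_iff, Prod.mk.injEq]

theorem exists_smul_apply (g : G) (s : Finset (Fin d)) :
    ∃ g' : G, ∀ j x, g' • S.toHomeo (j, x) = S.toHomeo (j, if j ∈ s then g • x else x) := by
  induction s using Finset.induction_on with
  | empty => exact ⟨1, fun j x => by simp⟩
  | insert i s his ih =>
    obtain ⟨g', hg'⟩ := ih
    refine ⟨S.loc i g * g', fun j x => ?_⟩
    rw [mul_smul, hg', S.loc_smul]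
    by_cases hji : j = i
    · subst hji
      simp [his]
    · simp [hji]

/-- The part of `X` that corresponds to `U` in each of the copies. -/
def base (U : Set X) : Set X := {x | (S.toHomeo.symm x).2 ∈ U}

theorem apply_mem_base {U : Set X} {j : Fin d} {u : X} : S.toHomeo (j, u) ∈ S.base U ↔ u ∈ U := by
  simp [base]

theorem isClopen_base {U : Set X} (hU : IsClopen U) : IsClopen (S.base U) :=
  hU.preimage (continuous_snd.comp S.toHomeo.symm.continuous)

theorem isOpen_cylinder (j : Fin d) : IsOpen {x | (S.toHomeo.symm x).1 = j} :=
  (isOpen_discrete {j}).preimage (continuous_fst.comp S.toHomeo.symm.continuous)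

/-- The orbits of a self-similar action are infinite. -/
theorem infinite_orbit (S : SelfSimilarity G X d) (hd : 5 ≤ d) (x : X) : (MulAction.orbit G x).Infinite := by
  intro hfin
  -- Descent: a finite orbit of a point of a copy contains the orbit of its second coordinate once
  -- in every copy, so the latter orbit is strictly smaller.
  induction hn : (MulAction.orbit G x).ncard using Nat.strong_induction_on generalizing x with
  | _ n ih =>
    obtain ⟨i, u, rfl⟩ := S.exists_eq x
    have hsub : ∀ j, (fun v => S.toHomeo (j, v)) '' MulAction.orbit G u ⊆
        MulAction.orbit G (S.toHomeo (i, u)) := by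
      rintro j _ ⟨_, ⟨g, rfl⟩, rfl⟩
      have hroot : ∃ σ : alternatingGroup (Fin d), σ.1 i = j := by
        by_cases hij : i = j
        · exact ⟨1, hij⟩
        · obtain ⟨k, _, ⟨h1, h2, -⟩, -⟩ := exists_two_ne hd i j j
          obtain ⟨σ, -, h, -⟩ := exists_threeCycle hij h1.symm h2.symm
          exact ⟨σ, h⟩
      obtain ⟨σ, hσ⟩ := hroot
      refine ⟨S.root σ * S.loc i g, ?_⟩
      change (S.root σ * S.loc i g) • _ = _
      rw [mul_smul, S.loc_smul, if_pos rfl, S.root_smul, hσ]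
    have hinj : ∀ j, Function.Injective fun v => S.toHomeo (j, v) := fun j v w h =>
      (S.apply_inj.1 h).2
    have hfu : (MulAction.orbit G u).Finite :=
      (hfin.subset (hsub i)).of_finite_image (hinj i).injOn
    obtain ⟨j, _, ⟨hji, -⟩, -⟩ := exists_two_ne hd i i i
    have hlt : (MulAction.orbit G u).ncard < n := by
      have hdisj : Disjoint ((fun v => S.toHomeo (i, v)) '' MulAction.orbit G u)
          ((fun v => S.toHomeo (j, v)) '' MulAction.orbit G u) := by
        rw [Set.disjoint_left]
        rintro _ ⟨v, _, rfl⟩ ⟨w, _, hw⟩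
        exact hji (S.apply_inj.1 hw).1
      have h1 := Set.ncard_le_ncard (Set.union_subset (hsub i) (hsub j)) hfin
      rw [Set.ncard_union_eq hdisj (hfu.image _) (hfu.image _), Set.ncard_image_of_injective _
        (hinj i), Set.ncard_image_of_injective _ (hinj j), hn] at h1
      have h2 : 0 < (MulAction.orbit G u).ncard :=
        (Set.ncard_pos hfu).2 ⟨u, MulAction.mem_orbit_self u⟩
      omega
    exact ih _ hlt u hfu rfl

variable [ContinuousConstSMul G X]

theorem isInvariant_base (σ : alternatingGroup (Fin d)) (U : Set X) :
    IsInvariant (toFull X (S.root σ)) (S.base U) := fun x => by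
  obtain ⟨j, u, rfl⟩ := S.exists_eq x
  rw [toFull_smul, S.root_smul, apply_mem_base, apply_mem_base]

/-- The permutation `σ` of the copies, restricted to the points that lie over `U`. -/
noncomputable def cyc (U : Set X) (hU : IsClopen U) :
    alternatingGroup (Fin d) →* topologicalFullGroup G X where
  toFun σ := restr (toFull X (S.root σ)) (S.base U) (S.isClopen_base hU) (S.isInvariant_base σ U)
  map_one' := restr_eq_one fun x _ => by
    obtain ⟨j, u, rfl⟩ := S.exists_eq x
    rw [toFull_smul, S.root_smul]
    rfl
  map_mul' σ τ := fullGroup_ext fun x => by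
    obtain ⟨j, u, rfl⟩ := S.exists_eq x
    rw [mul_smul]
    by_cases hu : u ∈ U
    · rw [restr_smul_of_mem (S.apply_mem_base.2 hu), restr_smul_of_mem (S.apply_mem_base.2 hu),
        toFull_smul, toFull_smul, S.root_smul, S.root_smul,
        restr_smul_of_mem (S.apply_mem_base.2 hu), toFull_smul, S.root_smul]
      rfl
    · have hu' := fun j : Fin d => mt (S.apply_mem_base (j := j)).1 hu
      rw [restr_smul_of_notMem (hu' _), restr_smul_of_notMem (hu' _),
        restr_smul_of_notMem (hu' _)]

theorem cyc_smul_of_mem {U : Set X} {hU : IsClopen U} {u : X} (hu : u ∈ U)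
    (σ : alternatingGroup (Fin d)) (j : Fin d) :
    S.cyc U hU σ • S.toHomeo (j, u) = S.toHomeo (σ.1 j, u) :=
  (restr_smul_of_mem (hV := S.isClopen_base hU) (hf := S.isInvariant_base σ U)
    (S.apply_mem_base.2 hu)).trans (S.root_smul σ j u)

theorem cyc_smul_of_notMem {U : Set X} {hU : IsClopen U} {u : X} (hu : u ∉ U)
    (σ : alternatingGroup (Fin d)) (j : Fin d) :
    S.cyc U hU σ • S.toHomeo (j, u) = S.toHomeo (j, u) :=
  restr_smul_of_notMem (hV := S.isClopen_base hU) (hf := S.isInvariant_base σ U)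
    (mt S.apply_mem_base.1 hu)

theorem full_ext {f g : topologicalFullGroup G X}
    (h : ∀ j u, f • S.toHomeo (j, u) = g • S.toHomeo (j, u)) : f = g :=
  fullGroup_ext fun x => by
    obtain ⟨j, u, rfl⟩ := S.exists_eq x
    exact h j u

theorem cyc_univ (σ : alternatingGroup (Fin d)) :
    S.cyc Set.univ isClopen_univ σ = toFull X (S.root σ) :=
  S.full_ext fun j u => by rw [S.cyc_smul_of_mem (Set.mem_univ u), toFull_smul, S.root_smul]

/-- If a subgroup of the full group contains `G` and the elements `cyc U σ` for `U` in a generating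
set of an invariant algebra, then it contains `cyc U σ` for all `U` in this algebra. -/
theorem isInvariantAlgebra_cyc_mem (hd : 5 ≤ d) {H : Subgroup (topologicalFullGroup G X)}
    (hH : ∀ g : G, toFull X g ∈ H) :
    IsInvariantAlgebra G {U : Set X | ∃ hU, ∀ σ, S.cyc U hU σ ∈ H} where
  univ_mem := ⟨isClopen_univ, fun σ => by rw [S.cyc_univ]; exact hH _⟩
  compl_mem := by
    rintro U ⟨hU, h⟩
    refine ⟨hU.compl, fun σ => ?_⟩
    have : S.cyc Uᶜ hU.compl σ = toFull X (S.root σ) * (S.cyc U hU σ⁻¹) := by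
      refine S.full_ext fun j u => ?_
      rw [mul_smul]
      by_cases hu : u ∈ U
      · rw [S.cyc_smul_of_notMem (U := Uᶜ) (fun h => h hu), S.cyc_smul_of_mem hu, toFull_smul, S.root_smul]
        simp
      · rw [S.cyc_smul_of_mem (U := Uᶜ) hu, S.cyc_smul_of_notMem hu, toFull_smul, S.root_smul]
    rw [this]
    exact mul_mem (hH _) (h _)
  inter_mem := by
    rintro U ⟨hU, h⟩ V ⟨hV, h'⟩
    refine ⟨hU.inter hV, fun σ => ?_⟩
    -- The two factors `cyc U σ` and `cyc V τ` act together only over `U ∩ V`, and elsewhere their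
    -- commutator cancels. This yields commutators of permutations only, which is enough by
    -- perfectness.
    have hle : commutator (alternatingGroup (Fin d)) ≤ H.comap (S.cyc (U ∩ V) (hU.inter hV)) := by
      rw [commutator_def, Subgroup.commutator_le]
      intro σ _ τ _
      rw [Subgroup.mem_comap]
      have : S.cyc (U ∩ V) (hU.inter hV) ⁅σ, τ⁆ = ⁅S.cyc U hU σ, S.cyc V hV τ⁆ := by
        refine S.full_ext fun j u => ?_
        simp only [commutatorElement_def, ← map_inv, mul_smul]
        by_cases hu : u ∈ U <;> by_cases hv : u ∈ V
        · simp only [S.cyc_smul_of_mem (U := U ∩ V) ⟨hu, hv⟩, S.cyc_smul_of_mem hu,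
            S.cyc_smul_of_mem hv]
          rfl
        · simp only [S.cyc_smul_of_notMem (U := U ∩ V) (fun h => hv h.2), S.cyc_smul_of_mem hu,
            S.cyc_smul_of_notMem hv]
          simp
        · simp only [S.cyc_smul_of_notMem (U := U ∩ V) (fun h => hu h.1), S.cyc_smul_of_mem hv,
            S.cyc_smul_of_notMem hu]
          simp
        · simp only [S.cyc_smul_of_notMem (U := U ∩ V) (fun h => hu h.1), S.cyc_smul_of_notMem hv,
            S.cyc_smul_of_notMem hu]
      rw [this, commutatorElement_def]
      exact mul_mem (mul_mem (mul_mem (h _) (h' _)) (inv_mem (h _))) (inv_mem (h' _))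
    rw [commutator_alternatingGroup_eq_top (by simpa using hd)] at hle
    exact hle (Subgroup.mem_top σ)
  smul_mem := by
    rintro g U ⟨hU, h⟩
    refine ⟨hU.preimage (continuous_const_smul g), fun σ => ?_⟩
    -- The element `g'` acts as `g` in all copies at once, hence commutes with permutations of
    -- copies and only moves the set `U`.
    obtain ⟨g', hg'⟩ := S.exists_smul_apply g Finset.univ
    simp only [Finset.mem_univ, if_true] at hg'
    have : S.cyc _ (hU.preimage (continuous_const_smul g)) σ =
        (toFull X g')⁻¹ * S.cyc U hU σ * toFull X g' := by
      refine S.full_ext fun j u => ?_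
      rw [mul_assoc, mul_smul, mul_smul, eq_inv_smul_iff, toFull_smul, toFull_smul, hg']
      by_cases hu : g • u ∈ U
      · rw [S.cyc_smul_of_mem (U := (g • ·) ⁻¹' U) hu, S.cyc_smul_of_mem hu, hg']
      · rw [S.cyc_smul_of_notMem (U := (g • ·) ⁻¹' U) hu, S.cyc_smul_of_notMem hu, hg']
    rw [this]
    exact mul_mem (mul_mem (inv_mem (hH _)) (h _)) (hH _)

end SelfSimilarity

/-! ## Three-cycles in the full group -/

section ThreeCycles

variable (G X : Type*) [Group G] [TopologicalSpace X] [MulAction G X] [ContinuousConstSMul G X]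

/-- The elements of the full group that are three-cycles of clopen sets. -/
def threeCycles : Set (topologicalFullGroup G X) :=
  {t | t ^ 3 = 1 ∧ ∀ p : X, t • p = p → ∀ᶠ y in 𝓝 p, t • y = y}

/-- The subgroup generated by the three-cycles. -/
def alternatingFull : Subgroup (topologicalFullGroup G X) := Subgroup.closure (threeCycles G X)

variable {G X}

theorem conj_mem_threeCycles {t : topologicalFullGroup G X} (ht : t ∈ threeCycles G X)
    (f : topologicalFullGroup G X) : f * t * f⁻¹ ∈ threeCycles G X := by
  refine ⟨by rw [conj_pow, ht.1, mul_one, mul_inv_cancel], fun p hp => ?_⟩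
  have hp' : t • f⁻¹ • p = f⁻¹ • p := by
    rw [eq_inv_smul_iff, ← mul_smul, ← mul_smul]
    exact hp
  filter_upwards [(continuous_const_smul f⁻¹).continuousAt.eventually (ht.2 _ hp')] with y hy
  rw [mul_smul, mul_smul, hy, smul_inv_smul]

instance : (alternatingFull G X).Normal := by
  have : alternatingFull G X = Subgroup.normalClosure (threeCycles G X) := by
    refine le_antisymm Subgroup.closure_le_normalClosure ?_
    refine Subgroup.closure_mono fun t ht => ?_
    obtain ⟨s, hs, hst⟩ := Group.mem_conjugatesOfSet_iff.1 ht
    obtain ⟨f, rfl⟩ := isConj_iff.1 hst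
    exact conj_mem_threeCycles hs f
  rw [this]
  infer_instance

namespace SelfSimilarity

variable {d : ℕ} (S : SelfSimilarity G X d)

/-- A fixed point lies either in a copy whose letter is fixed by `σ` or over the complement of `U`,
and both of these sets are open and fixed pointwise. -/
theorem cyc_mem_threeCycles {U : Set X} (hU : IsClopen U) {σ : alternatingGroup (Fin d)}
    (hσ : σ ^ 3 = 1) : S.cyc U hU σ ∈ threeCycles G X := by
  refine ⟨by rw [← map_pow, hσ, map_one], fun p hp => ?_⟩
  obtain ⟨j, u, rfl⟩ := S.exists_eq p
  by_cases hj : σ.1 j = j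
  · filter_upwards [(S.isOpen_cylinder j).mem_nhds (x := S.toHomeo (j, u)) (by simp)] with y hy
    obtain ⟨i, v, rfl⟩ := S.exists_eq y
    obtain rfl : i = j := by simpa using hy
    by_cases hv : v ∈ U
    · rw [S.cyc_smul_of_mem hv, hj]
    · rw [S.cyc_smul_of_notMem hv]
  · have hu : u ∉ U := fun hu => by
      rw [S.cyc_smul_of_mem hu, apply_inj] at hp
      exact hj hp.1
    filter_upwards [(S.isClopen_base hU).compl.isOpen.mem_nhds
      (x := S.toHomeo (j, u)) (mt S.apply_mem_base.1 hu)] with y hy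
    exact restr_smul_of_notMem (hV := S.isClopen_base hU) (hf := S.isInvariant_base σ U) hy

theorem cyc_mem_alternatingFull {U : Set X} (hU : IsClopen U) {σ : alternatingGroup (Fin d)}
    (hσ : σ ^ 3 = 1) : S.cyc U hU σ ∈ alternatingFull G X :=
  Subgroup.subset_closure (S.cyc_mem_threeCycles hU hσ)

/-- Let `t` rotate the copies `i`, `j`, `k` and let `f` act as `g` on copy `i` alone. Normality puts
`f t f⁻¹ t⁻¹` in the alternating full group, and on copy `i` it acts as `f`: `t⁻¹` moves the point
to copy `k`, which `f⁻¹` fixes, and `t` brings it back. Thus infinite orbits of `G` give infinite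
orbits here. -/
theorem infinite_orbit_alternatingFull (S : SelfSimilarity G X d) (hd : 5 ≤ d) (x : X) :
    (MulAction.orbit (alternatingFull G X) x).Infinite := by
  obtain ⟨i, u, rfl⟩ := S.exists_eq x
  have hinj : Function.Injective fun v => S.toHomeo (i, v) := fun v w h => (S.apply_inj.1 h).2
  refine ((S.infinite_orbit hd u).image hinj.injOn).mono ?_
  rintro _ ⟨_, ⟨g, rfl⟩, rfl⟩
  obtain ⟨j, k, ⟨hj, -⟩, ⟨hk, -⟩, hjk⟩ := exists_two_ne hd i i i
  obtain ⟨σ, hσ, h1, h2, h3, -⟩ := exists_threeCycle hj.symm hk.symm hjk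
  set t := S.cyc Set.univ isClopen_univ σ
  set f := toFull X (S.loc i g)
  have ht : t ∈ alternatingFull G X := S.cyc_mem_alternatingFull _ hσ
  have hmem : f * t * f⁻¹ * t⁻¹ ∈ alternatingFull G X :=
    mul_mem (Subgroup.Normal.conj_mem inferInstance _ ht f) (inv_mem ht)
  refine ⟨⟨_, hmem⟩, ?_⟩
  change (f * t * f⁻¹ * t⁻¹) • S.toHomeo (i, u) = S.toHomeo (i, g • u)
  have e1 : t⁻¹ • S.toHomeo (i, u) = S.toHomeo (k, u) := by
    rw [inv_smul_eq_iff, S.cyc_smul_of_mem (Set.mem_univ u), h3]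
  have e2 : f⁻¹ • S.toHomeo (k, u) = S.toHomeo (k, u) := by
    rw [inv_smul_eq_iff, toFull_smul, S.loc_smul, if_neg hk]
  rw [mul_smul, mul_smul, mul_smul, e1, e2, S.cyc_smul_of_mem (Set.mem_univ u), h3, toFull_smul,
    S.loc_smul, if_pos rfl]

end SelfSimilarity

end ThreeCycles

/-! ### Generation of the alternating full group by local permutations of the copies -/

namespace SelfSimilarity

variable {G X : Type*} [Group G] [TopologicalSpace X] [MulAction G X]
  {d : ℕ} (S : SelfSimilarity G X d)

/-- The letter of the copy that contains a point. -/
def letter (x : X) : Fin d := (S.toHomeo.symm x).1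

theorem letter_apply (i : Fin d) (u : X) : S.letter (S.toHomeo (i, u)) = i := by simp [letter]

theorem exists_eq_of_letter {x : X} {i : Fin d} (h : S.letter x = i) :
    ∃ u, x = S.toHomeo (i, u) := by
  obtain ⟨j, u, rfl⟩ := S.exists_eq x
  rw [letter_apply] at h
  exact ⟨u, by rw [h]⟩

theorem eventually_letter (x : X) : ∀ᶠ y in 𝓝 x, S.letter y = S.letter x :=
  (S.isOpen_cylinder _).mem_nhds rfl

variable [ContinuousConstSMul G X]

theorem cyc_smul_of_letter_fixed {U : Set X} {hU : IsClopen U} {σ : alternatingGroup (Fin d)} {x : X}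
    (h : σ.1 (S.letter x) = S.letter x) : S.cyc U hU σ • x = x := by
  obtain ⟨j, u, rfl⟩ := S.exists_eq x
  rw [letter_apply] at h
  by_cases hu : u ∈ U
  · rw [S.cyc_smul_of_mem hu, h]
  · rw [S.cyc_smul_of_notMem hu]

section

variable [CompactSpace X] [T2Space X] [TotallyDisconnectedSpace X]

/-- A point can be moved to another copy while two other points stay fixed. -/
theorem exists_move (hd : 5 ≤ d) {H : Subgroup (topologicalFullGroup G X)}
    (hcyc : ∀ U hU σ, S.cyc U hU σ ∈ H) {p q r : X} (hpq : p ≠ q) (hpr : p ≠ r) :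
    ∃ h ∈ H, h • q = q ∧ h • r = r ∧ S.letter (h • p) ≠ S.letter q ∧
      S.letter (h • p) ≠ S.letter r := by
  obtain ⟨i, p, rfl⟩ := S.exists_eq p
  -- The permutation `(i l m)` over a small `U` moves `p` to copy `l`. It fixes `q` and `r`: in copy
  -- `i` they lie off `U`, and in any other case their letter is fixed by `σ`. Avoiding up to three
  -- letters twice is where `5 ≤ d` enters.
  obtain ⟨l, m, ⟨hli, hlq, hlr⟩, ⟨hmi, hmq, hmr⟩, hlm⟩ :=
    exists_two_ne hd i (S.letter q) (S.letter r)
  obtain ⟨σ, -, hσi, -, -, hσ⟩ := exists_threeCycle hli.symm hmi.symm hlm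
  have hO : IsOpen ((fun v => S.toHomeo (i, v)) ⁻¹' {q, r}ᶜ) :=
    (Set.toFinite {q, r}).isClosed.isOpen_compl.preimage
      (S.toHomeo.continuous.comp (Continuous.prodMk_right i))
  obtain ⟨U, hU, hpU, hUO⟩ := compact_exists_isClopen_in_isOpen hO (x := p) (by simp [hpq, hpr])
  have hfix : ∀ x ∈ ({q, r} : Set X), S.letter x ≠ l → S.letter x ≠ m →
      S.cyc U hU σ • x = x := by
    intro x hx h1 h2
    by_cases hxi : S.letter x = i
    · obtain ⟨v, rfl⟩ := S.exists_eq_of_letter hxi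
      exact S.cyc_smul_of_notMem (fun hv => hUO hv hx) σ i
    · exact S.cyc_smul_of_letter_fixed (hσ _ hxi h1 h2)
  refine ⟨_, hcyc U hU σ, hfix q (by simp) hlq.symm hmq.symm, hfix r (by simp) hlr.symm hmr.symm, ?_⟩
  rw [S.cyc_smul_of_mem hpU, hσi, letter_apply]
  exact ⟨hlq, hlr⟩

/-- Three distinct points can be moved to distinct copies. -/
theorem exists_separate (hd : 5 ≤ d) {H : Subgroup (topologicalFullGroup G X)}
    (hcyc : ∀ U hU σ, S.cyc U hU σ ∈ H) {p q r : X} (hpq : p ≠ q) (hpr : p ≠ r) (hqr : q ≠ r) :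
    ∃ h ∈ H, S.letter (h • p) ≠ S.letter (h • q) ∧ S.letter (h • p) ≠ S.letter (h • r) ∧
      S.letter (h • q) ≠ S.letter (h • r) := by
  obtain ⟨h, hH, hq, hr, h1, h2⟩ := S.exists_move hd hcyc hpq hpr
  obtain ⟨k, kH, kp, kr, k1, k2⟩ := S.exists_move hd hcyc (p := q) (q := h • p) (r := r)
    (fun e => h1 (by rw [← e])) hqr
  refine ⟨k * h, mul_mem kH hH, ?_⟩
  rw [mul_smul, mul_smul, mul_smul, hq, hr, kp, kr]
  exact ⟨k1.symm, h2, k2⟩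

/-- Small pieces of a three-cycle that permutes points in distinct copies. -/
theorem exists_restr_mem_of_letter_ne {H : Subgroup (topologicalFullGroup G X)}
    (hG : ∀ g : G, toFull X g ∈ H) (hcyc : ∀ U hU σ, S.cyc U hU σ ∈ H)
    {t : topologicalFullGroup G X} (ht : t ^ 3 = 1) {p : X}
    (h1 : S.letter p ≠ S.letter (t • p)) (h2 : S.letter p ≠ S.letter (t • t • p))
    (h3 : S.letter (t • p) ≠ S.letter (t • t • p)) :
    ∃ T ∈ 𝓝 p, IsClopen T ∧ IsInvariant t T ∧ ∀ V hV hf, V ⊆ T → restr t V hV hf ∈ H := by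
  have ht' : ∀ x : X, t • t • t • x = x := fun x => by
    rw [← mul_smul, ← mul_smul, ← pow_three', ht, one_smul]
  obtain ⟨m, hm⟩ := exists_eventually_smul_eq t p
  obtain ⟨n, hn⟩ := exists_eventually_smul_eq t (t • p)
  set i := S.letter p with hi
  set j := S.letter (t • p) with hj
  set k := S.letter (t • t • p) with hk
  have ct : Continuous (t • · : X → X) := continuous_const_smul t
  have hO : ∀ᶠ y in 𝓝 p, S.letter y = i ∧ S.letter (t • y) = j ∧ S.letter (t • t • y) = k ∧
      t • y = m • y ∧ t • t • y = n • t • y :=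
    (S.eventually_letter p).and (((ct.tendsto p).eventually (S.eventually_letter _)).and
      ((((ct.comp ct).tendsto p).eventually (S.eventually_letter _)).and
        (hm.and ((ct.tendsto p).eventually hn))))
  obtain ⟨O, hOs, hOo, hpO⟩ := eventually_nhds_iff.1 hO
  obtain ⟨U, hU, hpU, hUO⟩ := compact_exists_isClopen_in_isOpen hOo hpO
  have hU' : ∀ y ∈ U, S.letter y = i ∧ S.letter (t • y) = j ∧ S.letter (t • t • y) = k ∧
      t • y = m • y ∧ t • t • y = n • t • y := fun y hy => hOs y (hUO hy)
  have mi : S.perm m i = j := by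
    obtain ⟨u, hu⟩ := S.exists_eq_of_letter hi.symm
    have := (hU' p hpU).2.2.2.1
    rw [hj, this, hu, S.smul_apply, letter_apply]
  have nj : S.perm n j = k := by
    obtain ⟨u, hu⟩ := S.exists_eq_of_letter hj.symm
    have := (hU' p hpU).2.2.2.2
    rw [hk, this, hu, S.smul_apply, letter_apply]
  obtain ⟨σ, -, σi, σj, σk, σl⟩ := exists_threeCycle h1 h2 h3
  -- The saturation of `U` under `t`; since `t ^ 3 = 1`, three translates are enough.
  set T : Set X := U ∪ (t • · : X → X) ⁻¹' U ∪ (fun x => t • t • x) ⁻¹' U with hT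
  have hTc : IsClopen T := (hU.union (hU.preimage ct)).union (hU.preimage (ct.comp ct))
  have hTi : IsInvariant t T := fun x => by
    simp only [hT, Set.mem_union, Set.mem_preimage, ht']
    tauto
  refine ⟨T, hTc.isOpen.mem_nhds (Or.inl (Or.inl hpU)), hTc, hTi, fun V hV hf hVT => ?_⟩
  -- the part of `V` in the first copy
  have hWc : IsClopen ((fun v => S.toHomeo (i, v)) ⁻¹' (V ∩ U)) := (hV.inter hU).preimage
    (S.toHomeo.continuous.comp (Continuous.prodMk_right i))
  set W : Set X := (fun v => S.toHomeo (i, v)) ⁻¹' (V ∩ U) with hW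
  -- Near `p` and `t • p` the element `t` acts as `m` and `n`. Conjugating by `D`, which applies
  -- their sections inside copies `j` and `k`, turns a pure permutation of copies into `t`; the
  -- return from `k` to `i` is forced by `t ^ 3 = 1`.
  set D : G := S.loc j (S.sec m i) * S.loc k (S.sec n j * S.sec m i) with hD
  have Dl : ∀ l, l ≠ j → l ≠ k → ∀ u, toFull X D • S.toHomeo (l, u) = S.toHomeo (l, u) := by
    intro l hlj hlk u
    rw [toFull_smul, hD, mul_smul, S.loc_smul, if_neg hlk, S.loc_smul, if_neg hlj]
  have Dj : ∀ u, toFull X D • S.toHomeo (j, u) = S.toHomeo (j, S.sec m i • u) := by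
    intro u
    rw [toFull_smul, hD, mul_smul, S.loc_smul, if_neg h3, S.loc_smul, if_pos rfl]
  have Dk : ∀ u, toFull X D • S.toHomeo (k, u) = S.toHomeo (k, S.sec n j • S.sec m i • u) := by
    intro u
    rw [toFull_smul, hD, mul_smul, S.loc_smul, if_pos rfl, S.loc_smul, if_neg h3.symm, mul_smul]
  have tW : ∀ u ∈ W, t • S.toHomeo (i, u) = S.toHomeo (j, S.sec m i • u) ∧
      t • S.toHomeo (j, S.sec m i • u) = S.toHomeo (k, S.sec n j • S.sec m i • u) ∧
      t • S.toHomeo (k, S.sec n j • S.sec m i • u) = S.toHomeo (i, u) := by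
    intro u hu
    obtain ⟨-, -, -, e1, e2⟩ := hU' _ hu.2
    rw [S.smul_apply, mi] at e1
    rw [e1, S.smul_apply, nj] at e2
    refine ⟨e1, e2, ?_⟩
    rw [← e2, ← e1, ht']
  have hmem : ∀ u ∈ W, S.toHomeo (i, u) ∈ V ∧ S.toHomeo (j, S.sec m i • u) ∈ V ∧
      S.toHomeo (k, S.sec n j • S.sec m i • u) ∈ V := by
    intro u hu
    obtain ⟨e1, e2, -⟩ := tW u hu
    refine ⟨hu.1, ?_, ?_⟩
    · rw [← e1, hf]
      exact hu.1
    · rw [← e2, hf, ← e1, hf]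
      exact hu.1
  have hcov : ∀ x ∈ V, ∃ u ∈ W, x = S.toHomeo (i, u) ∨ x = S.toHomeo (j, S.sec m i • u) ∨
      x = S.toHomeo (k, S.sec n j • S.sec m i • u) := by
    have hWU : ∀ y ∈ V, y ∈ U → ∃ u ∈ W, y = S.toHomeo (i, u) := fun y hyV hyU => by
      obtain ⟨u, rfl⟩ := S.exists_eq_of_letter (hU' y hyU).1
      exact ⟨u, ⟨hyV, hyU⟩, rfl⟩
    intro x hx
    rcases hVT hx with (hxU | hxU) | hxU
    · obtain ⟨u, hu, rfl⟩ := hWU x hx hxU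
      exact ⟨u, hu, Or.inl rfl⟩
    · obtain ⟨u, hu, e⟩ := hWU (t • x) ((hf x).2 hx) hxU
      obtain ⟨e1, e2, -⟩ := tW u hu
      refine ⟨u, hu, Or.inr (Or.inr ?_)⟩
      rw [← e2, ← e1, ← e, ht']
    · obtain ⟨u, hu, e⟩ := hWU (t • t • x) ((hf _).2 ((hf x).2 hx)) hxU
      obtain ⟨e1, -, -⟩ := tW u hu
      refine ⟨u, hu, Or.inr (Or.inl ?_)⟩
      change t • t • x = _ at e
      rw [← e1, ← e, ht']
  have heq : restr t V hV hf = toFull X D * S.cyc W hWc σ * (toFull X D)⁻¹ := by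
    rw [eq_mul_inv_iff_mul_eq]
    refine S.full_ext fun l u => ?_
    rw [mul_smul, mul_smul]
    by_cases hu : u ∈ W
    · obtain ⟨e1, e2, e3⟩ := tW u hu
      obtain ⟨f1, f2, f3⟩ := hmem u hu
      rw [S.cyc_smul_of_mem hu]
      by_cases hli : l = i
      · rw [hli, σi, Dl i h1 h2, Dj, restr_smul_of_mem f1, e1]
      by_cases hlj : l = j
      · rw [hlj, σj, Dj, Dk, restr_smul_of_mem f2, e2]
      by_cases hlk : l = k
      · rw [hlk, σk, Dk, Dl i h1 h2, restr_smul_of_mem f3, e3]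
      rw [σl l hli hlj hlk, Dl l hlj hlk, restr_smul_of_notMem]
      intro hV
      obtain ⟨v, -, e | e | e⟩ := hcov _ hV <;> rw [apply_inj] at e
      exacts [hli e.1, hlj e.1, hlk e.1]
    · rw [S.cyc_smul_of_notMem hu, restr_smul_of_notMem]
      intro hV
      have e0 : ∀ v ∈ W, v ≠ u := fun v hv e => hu (e ▸ hv)
      obtain ⟨v, hv, e⟩ := hcov _ hV
      have e' : ∃ l', toFull X D • S.toHomeo (l, u) = toFull X D • S.toHomeo (l', v) := by
        rcases e with e | e | e
        exacts [⟨i, by rw [e, Dl i h1 h2]⟩, ⟨j, by rw [e, Dj]⟩, ⟨k, by rw [e, Dk]⟩]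
      obtain ⟨l', e'⟩ := e'
      exact e0 v hv (S.apply_inj.1 (smul_left_cancel _ e')).2.symm
  rw [heq]
  exact mul_mem (mul_mem (hG _) (hcyc _ _ _)) (inv_mem (hG _))

/-- It suffices to treat small restrictions of a three-cycle `t`. Near a fixed point they are
trivial, because the fixed-point set is open. Elsewhere `p`, `t • p`, `t • t • p` are distinct, an
element of `H` moves them to distinct copies, and `exists_restr_mem_of_letter_ne` applies to the
conjugate of `t`. -/
theorem alternatingFull_le (hd : 5 ≤ d) {H : Subgroup (topologicalFullGroup G X)}
    (hG : ∀ g : G, toFull X g ∈ H) (hcyc : ∀ U hU σ, S.cyc U hU σ ∈ H) :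
    alternatingFull G X ≤ H := by
  rw [alternatingFull, Subgroup.closure_le]
  rintro t ⟨ht, hfix⟩
  have ht' : ∀ x : X, t • t • t • x = x := fun x => by
    rw [← mul_smul, ← mul_smul, ← pow_three', ht, one_smul]
  refine mem_of_forall_restr_mem H fun p => ?_
  by_cases hp : t • p = p
  · obtain ⟨O, hO, hOo, hpO⟩ := eventually_nhds_iff.1 (hfix p hp)
    obtain ⟨T, hT, hTi, hpT, hTO⟩ := exists_isClopen_isInvariant
      (isOfFinOrder_iff_pow_eq_one.2 ⟨3, by norm_num, ht⟩) hOo (x := p) fun k => by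
        have : t ^ k • p = p := by
          induction k with
          | zero => simp
          | succ k ih => rw [pow_succ, mul_smul, hp, ih]
        rwa [this]
    refine ⟨T, hT.isOpen.mem_nhds hpT, hT, hTi, fun V hV hf hVT => ?_⟩
    rw [restr_eq_one fun x hx => hO x (hTO (hVT hx))]
    exact one_mem _
  · have hp2 : p ≠ t • t • p := fun e => hp (by
      conv_lhs => rw [e]
      exact ht' p)
    have hp3 : t • p ≠ t • t • p := fun e => hp (smul_left_cancel t e).symm
    obtain ⟨h, hH, h1, h2, h3⟩ := S.exists_separate hd hcyc (Ne.symm hp) hp2 hp3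
    have e1 : (h * t * h⁻¹) • h • p = h • t • p := by
      rw [mul_smul, mul_smul, inv_smul_smul]
    have e2 : (h * t * h⁻¹) • (h * t * h⁻¹) • h • p = h • t • t • p := by
      rw [e1, mul_smul, mul_smul, inv_smul_smul]
    obtain ⟨T, hTn, hT, hTi, hTV⟩ := S.exists_restr_mem_of_letter_ne hG hcyc
      (t := h * t * h⁻¹) (by rw [conj_pow, ht, mul_one, mul_inv_cancel]) (p := h • p)
      (by rwa [e1]) (by rwa [e2]) (by rwa [e2, e1])
    have ch : Continuous (h • · : X → X) := continuous_const_smul h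
    have ch' : Continuous (h⁻¹ • · : X → X) := continuous_const_smul h⁻¹
    refine ⟨(h • · : X → X) ⁻¹' T, ch.continuousAt.preimage_mem_nhds hTn, hT.preimage ch, ?_,
      fun V hV hf hVT => ?_⟩
    · intro x
      have := hTi (h • x)
      rwa [mul_smul, mul_smul, inv_smul_smul] at this
    · have hmem := hTV _ (hV.preimage ch') (isInvariant_conj hf) (fun x hx => by
        have := hVT hx
        rwa [Set.mem_preimage, smul_inv_smul] at this)
      rw [restr_conj (hV := hV) (hf := hf)] at hmem
      simpa [mul_assoc] using mul_mem (mul_mem (inv_mem hH) hmem) hH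

/-- The derived subgroup of the subgroup generated by the torsion elements of the full group of a
self-similar action is finitely generated, if the acting group is generated by finitely many torsion
elements and the invariant algebra of all clopen sets is finitely generated. -/
theorem fg_commutator_torsionGenerated_full (S : SelfSimilarity G X d) (hd : 5 ≤ d) {s : Set G}
    (hs : s.Finite) (hs' : ∀ g ∈ s, IsOfFinOrder g) (hsG : Subgroup.closure s = ⊤)
    {D : Set (Set X)} (hD : D.Finite) (hDc : ∀ U ∈ D, IsClopen U)
    (hDA : ∀ A : Set (Set X), IsInvariantAlgebra G A → D ⊆ A → ∀ U, IsClopen U → U ∈ A) :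
    Group.FG (commutator (torsionGenerated (topologicalFullGroup G X))) := by
  have hcycfin : {c | ∃ U hU σ, U ∈ D ∧ c = S.cyc U hU σ}.Finite := by
    refine (hD.biUnion (t := fun U => {c | ∃ hU σ, c = S.cyc U hU σ}) fun U _ => ?_).subset ?_
    · by_cases hU : IsClopen U
      · refine (Set.finite_range (S.cyc U hU)).subset ?_
        rintro _ ⟨_, σ, rfl⟩
        exact ⟨σ, rfl⟩
      · refine Set.finite_empty.subset ?_
        rintro _ ⟨hU', -⟩
        exact hU hU'
    · rintro _ ⟨U, hU, σ, hUD, rfl⟩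
      exact Set.mem_biUnion hUD ⟨hU, σ, rfl⟩
  set gen : Set (topologicalFullGroup G X) :=
    toFull X '' s ∪ {c | ∃ U hU σ, U ∈ D ∧ c = S.cyc U hU σ} with hgen
  have hG : ∀ g : G, toFull X g ∈ Subgroup.closure gen := by
    have : (⊤ : Subgroup G) ≤ (Subgroup.closure gen).comap (toFull X) := by
      rw [← hsG, Subgroup.closure_le]
      exact fun g hg => Subgroup.subset_closure (Or.inl ⟨g, hg, rfl⟩)
    exact fun g => this (Subgroup.mem_top g)
  have hcyc : ∀ U hU σ, S.cyc U hU σ ∈ Subgroup.closure gen := by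
    intro U hU
    obtain ⟨_, h⟩ := hDA _ (S.isInvariantAlgebra_cyc_mem hd hG) (fun V hV =>
      ⟨hDc V hV, fun σ => Subgroup.subset_closure (Or.inr ⟨V, hDc V hV, σ, hV, rfl⟩)⟩) U hU
    exact h
  refine fg_commutator_torsionGenerated (S := gen) ((hs.image _).union hcycfin) ?_
    (N := alternatingFull G X) (S.alternatingFull_le hd hG hcyc) ?_
  · rintro _ (⟨g, hg, rfl⟩ | ⟨U, hU, σ, -, rfl⟩)
    · exact MonoidHom.isOfFinOrder (toFull X) (hs' g hg)
    · exact MonoidHom.isOfFinOrder (S.cyc U hU) (isOfFinOrder_of_finite σ)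
  · exact fun a b ha hb =>
      commutator_mem_of_isOfFinOrder (S.infinite_orbit_alternatingFull hd) ha hb

end

end SelfSimilarity

/-! ## Wreath recursions -/

section Wreath

variable {d : ℕ}

theorem treeAut_nil (g : treeAut d) : g.1 [] = [] := List.length_eq_zero_iff.1 (g.2.1 [])

theorem treeAut_mul_apply (g h : treeAut d) (w : Vertex d) : (g * h).1 w = g.1 (h.1 w) := rfl

namespace HasWreathRecursion

variable {g h : treeAut d} {s t : Fin d → treeAut d} {ρ τ : Equiv.Perm (Fin d)}

theorem mul (hg : HasWreathRecursion g s ρ) (hh : HasWreathRecursion h t τ) :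
    HasWreathRecursion (g * h) (fun x => s (τ x) * t x) (ρ * τ) := fun x w => by
  rw [treeAut_mul_apply, hh, hg]
  rfl

theorem one : HasWreathRecursion (1 : treeAut d) (fun _ => 1) 1 := fun _ _ => rfl

theorem inv (hg : HasWreathRecursion g s ρ) :
    HasWreathRecursion g⁻¹ (fun x => (s (ρ⁻¹ x))⁻¹) ρ⁻¹ := fun x w => by
  change g.1⁻¹ (x :: w) = _
  rw [Equiv.Perm.inv_eq_iff_eq, hg]
  change _ = ρ (ρ⁻¹ x) :: (s (ρ⁻¹ x)).1 ((s (ρ⁻¹ x)).1⁻¹ w)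
  simp

theorem perm_eq (hg : HasWreathRecursion g s ρ) (hg' : HasWreathRecursion g t τ) : ρ = τ :=
  Equiv.ext fun x => (List.cons.inj ((hg x []).symm.trans (hg' x []))).1

theorem sec_eq (hg : HasWreathRecursion g s ρ) (hg' : HasWreathRecursion g t τ) : s = t :=
  funext fun x => Subtype.ext <| Equiv.ext fun w =>
    (List.cons.inj ((hg x w).symm.trans (hg' x w))).2

theorem ext (hg : HasWreathRecursion g s ρ) (hh : HasWreathRecursion h s ρ) : g = h :=
  Subtype.ext <| Equiv.ext fun w => by
    cases w with
    | nil => rw [treeAut_nil, treeAut_nil]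
    | cons x w => rw [hg, hh]

end HasWreathRecursion

theorem hasWreathRecursion_rooted (σ : Equiv.Perm (Fin d)) :
    HasWreathRecursion (rooted σ) (fun _ => 1) σ := fun _ _ => rfl

theorem rooted_mul (σ τ : Equiv.Perm (Fin d)) : rooted (σ * τ) = rooted σ * rooted τ := by
  refine (hasWreathRecursion_rooted _).ext ?_
  simpa using (hasWreathRecursion_rooted σ).mul (hasWreathRecursion_rooted τ)

/-- The embedding of the permutations of the alphabet in the automorphisms of the tree. -/
def rootedHom (d : ℕ) : Equiv.Perm (Fin d) →* treeAut d :=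
  MonoidHom.mk' rooted rooted_mul

/-- The subgroup `A`. -/
def subgroupA (d : ℕ) : Subgroup (treeAut d) := (alternatingGroup (Fin d)).map (rootedHom d)

theorem mem_subgroupA {g : treeAut d} : g ∈ subgroupA d ↔ g ∈ setA d := by
  rw [subgroupA, Subgroup.mem_map]
  exact exists_congr fun σ => and_congr_right fun _ => eq_comm

theorem finite_setA : (setA d).Finite :=
  (Set.finite_range rooted).subset fun _ ⟨σ, _, h⟩ => ⟨σ, h.symm⟩

/-- The recursive elements with sections `σ` and action `ρ` on the alphabet. -/
def directedFun [NeZero d] (σ : Fin d → Equiv.Perm (Fin d)) (ρ : Equiv.Perm (Fin d)) :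
    Vertex d → Vertex d
  | [] => []
  | x :: w => if x = 0 then 0 :: directedFun σ ρ w else ρ x :: rootedFun (σ x) w

variable [NeZero d]

theorem directedFun_comp {σ σ' : Fin d → Equiv.Perm (Fin d)} {ρ ρ' : Equiv.Perm (Fin d)}
    (hρ : ρ 0 = 0) (w : Vertex d) : directedFun σ' ρ' (directedFun σ ρ w) =
      directedFun (fun x => σ' (ρ x) * σ x) (ρ' * ρ) w := by
  induction w with
  | nil => rfl
  | cons x w ih =>
    by_cases hx : x = 0
    · simp [directedFun, hx, ih]
    · have hx' : ρ x ≠ 0 := fun h => hx (ρ.injective (h.trans hρ.symm))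
      simp only [directedFun, hx, hx', if_false, Equiv.Perm.mul_apply]
      congr 1
      exact (congrArg (fun g : treeAut d => g.1 w) (rooted_mul (σ' (ρ x)) (σ x))).symm

theorem directedFun_one (w : Vertex d) : directedFun (fun _ => 1) 1 w = w := by
  induction w with
  | nil => rfl
  | cons x w ih =>
    by_cases hx : x = 0
    · simp [directedFun, hx, ih]
    · simp only [directedFun, hx, if_false, Equiv.Perm.one_apply]
      cases w <;> rfl

theorem directedFun_prefix {σ : Fin d → Equiv.Perm (Fin d)} {ρ : Equiv.Perm (Fin d)}
    (hρ : ρ 0 = 0) (u v : Vertex d) : directedFun σ ρ u <+: directedFun σ ρ v ↔ u <+: v := by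
  induction u generalizing v with
  | nil => simp [directedFun]
  | cons x u ih =>
    cases v with
    | nil => by_cases hx : x = 0 <;> simp [directedFun, hx]
    | cons y v =>
      have hne : ∀ z, z ≠ 0 → ρ z ≠ 0 := fun z hz h => hz (ρ.injective (h.trans hρ.symm))
      by_cases hx : x = 0 <;> by_cases hy : y = 0
      · simp [directedFun, hx, hy, List.cons_prefix_cons, ih]
      · simp [directedFun, hx, hy, List.cons_prefix_cons, (hne y hy).symm, Ne.symm hy]
      · simp [directedFun, hx, hy, List.cons_prefix_cons, hne x hx]
      · simp only [directedFun, hx, hy, if_false, List.cons_prefix_cons, ρ.injective.eq_iff]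
        refine and_congr_right fun hxy => ?_
        rw [hxy]
        exact (rooted (σ y)).2.2 u v

theorem length_directedFun (σ : Fin d → Equiv.Perm (Fin d)) (ρ : Equiv.Perm (Fin d))
    (w : Vertex d) : (directedFun σ ρ w).length = w.length := by
  induction w with
  | nil => rfl
  | cons x w ih =>
    by_cases hx : x = 0
    · simp [directedFun, hx, ih]
    · simp only [directedFun, hx, if_false, List.length_cons]
      exact congrArg (· + 1) ((rooted (σ x)).2.1 w)

/-- The automorphism `g = (g, σ_1, …, σ_{d-1}) ρ`. -/
def directed (σ : Fin d → Equiv.Perm (Fin d)) (ρ : Equiv.Perm (Fin d)) (hρ : ρ 0 = 0) :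
    treeAut d where
  val :=
    { toFun := directedFun σ ρ
      invFun := directedFun (fun x => (σ (ρ⁻¹ x))⁻¹) ρ⁻¹
      left_inv := fun w => by
        rw [directedFun_comp hρ]
        simpa using directedFun_one w
      right_inv := fun w => by
        rw [directedFun_comp (Equiv.Perm.inv_eq_iff_eq.2 hρ.symm)]
        simpa using directedFun_one w }
  property := ⟨length_directedFun σ ρ, directedFun_prefix hρ⟩

theorem hasWreathRecursion_directed (σ : Fin d → Equiv.Perm (Fin d)) (ρ : Equiv.Perm (Fin d))
    (hρ : ρ 0 = 0) : HasWreathRecursion (directed σ ρ hρ)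
      (fun x => if x.val = 0 then directed σ ρ hρ else rooted (σ x)) ρ := fun x w => by
  by_cases hx : x = 0
  · subst hx
    simp only [Fin.val_zero, if_true, hρ]
    change directedFun σ ρ (0 :: w) = _
    rw [directedFun, if_pos rfl]
    rfl
  · have hx' : x.val ≠ 0 := fun h => hx (Fin.ext (by simpa using h))
    simp only [hx', if_false]
    change directedFun σ ρ (x :: w) = _
    rw [directedFun, if_neg hx]
    rfl

theorem directed_mem_setB {σ : Fin d → Equiv.Perm (Fin d)} {ρ : Equiv.Perm (Fin d)}
    (hρ : ρ 0 = 0) (hσ : ∀ x, σ x ∈ alternatingGroup (Fin d)) (hρ' : ρ ∈ alternatingGroup (Fin d)) :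
    directed σ ρ hρ ∈ setB d :=
  ⟨σ, ρ, hρ', hσ, fun x hx => by rw [show x = 0 from Fin.ext (by simpa using hx), hρ],
    hasWreathRecursion_directed σ ρ hρ⟩

/-- The recursion refers to `g` itself only on a shorter word, so it determines `g`. This is why `B`
is finite: its elements are parametrised by `σ` and `ρ`. -/
theorem eq_directed {g : treeAut d} {σ : Fin d → Equiv.Perm (Fin d)} {ρ : Equiv.Perm (Fin d)}
    (hρ : ρ 0 = 0)
    (hg : HasWreathRecursion g (fun x => if x.val = 0 then g else rooted (σ x)) ρ) :
    g = directed σ ρ hρ := by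
  refine Subtype.ext (Equiv.ext fun w => ?_)
  induction w with
  | nil => rw [treeAut_nil, treeAut_nil]
  | cons x w ih =>
    rw [hg, hasWreathRecursion_directed]
    by_cases hx : x.val = 0
    · simp only [hx, if_true, ih]
    · simp only [hx, if_false]

theorem finite_setB : (setB d).Finite := by
  refine (Set.finite_range fun z : (Fin d → Equiv.Perm (Fin d)) × {ρ : Equiv.Perm (Fin d) // ρ 0 = 0}
    => directed z.1 z.2.1 z.2.2).subset ?_
  rintro g ⟨σ, ρ, -, -, hρ, hg⟩
  exact ⟨(σ, ⟨ρ, hρ 0 rfl⟩), (eq_directed (hρ 0 rfl) hg).symm⟩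

/-- The subgroup `B`. -/
def subgroupB (d : ℕ) [NeZero d] : Subgroup (treeAut d) where
  carrier := setB d
  one_mem' := by
    refine ⟨fun _ => 1, 1, one_mem _, fun _ => one_mem _, fun _ _ => rfl, ?_⟩
    have : (fun x : Fin d => if x.val = 0 then (1 : treeAut d) else rooted 1) = fun _ => 1 := by
      funext x
      rw [show rooted (1 : Equiv.Perm (Fin d)) = 1 from map_one (rootedHom d), ite_self]
    rw [this]
    exact HasWreathRecursion.one
  mul_mem' := by
    rintro g h ⟨σ, ρ, hρ, hσ, hρ0, hg⟩ ⟨σ', ρ', hρ', hσ', hρ0', hh⟩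
    refine ⟨fun x => σ (ρ' x) * σ' x, ρ * ρ', mul_mem hρ hρ', fun x => mul_mem (hσ _) (hσ' _),
      fun x hx => by rw [Equiv.Perm.mul_apply, hρ0' x hx, hρ0 x hx], ?_⟩
    convert hg.mul hh using 1
    funext x
    by_cases hx : x.val = 0
    · simp only [hx, if_true, hρ0' x hx]
    · have : (ρ' x).val ≠ 0 := fun h => hx (by
        have := ρ'.injective (hρ0' _ h)
        rwa [this] at h)
      simp only [hx, this, if_false, rooted_mul]
  inv_mem' := by
    rintro g ⟨σ, ρ, hρ, hσ, hρ0, hg⟩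
    have hi0 : ∀ x : Fin d, x.val = 0 → ρ⁻¹ x = x := fun x hx => by
      rw [Equiv.Perm.inv_eq_iff_eq, hρ0 x hx]
    refine ⟨fun x => (σ (ρ⁻¹ x))⁻¹, ρ⁻¹, inv_mem hρ, fun x => inv_mem (hσ _), hi0, ?_⟩
    convert hg.inv using 1
    funext x
    by_cases hx : x.val = 0
    · simp only [hx, if_true, hi0 x hx]
    · have : (ρ⁻¹ x).val ≠ 0 := fun h => hx (by
        have h' := hρ0 _ h
        rw [← Equiv.Perm.mul_apply, mul_inv_cancel, Equiv.Perm.one_apply] at h'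
        rwa [← h'] at h)
      simp only [hx, this, if_false]
      exact map_inv (rootedHom d) _

theorem isOfFinOrder_of_mem {g : treeAut d} (hg : g ∈ setA d ∪ setB d) : IsOfFinOrder g := by
  rcases hg with ⟨σ, -, rfl⟩ | hg
  · exact MonoidHom.isOfFinOrder (rootedHom d) (isOfFinOrder_of_finite σ)
  · have : Finite (subgroupB d) := finite_setB.to_subtype
    exact Submonoid.isOfFinOrder_coe.2 (isOfFinOrder_of_finite (⟨g, hg⟩ : subgroupB d))

end Wreath

/-! ## The self-similar structure of the mother group -/

section Mother

theorem exists_alternating_apply_eq {d : ℕ} (hd : 5 ≤ d) (i j : Fin d) :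
    ∃ σ : alternatingGroup (Fin d), σ.1 i = j := by
  by_cases hij : i = j
  · exact ⟨1, hij⟩
  · obtain ⟨k, _, ⟨h1, h2, -⟩, -⟩ := exists_two_ne hd i j j
    obtain ⟨σ, -, h, -⟩ := exists_threeCycle hij h1.symm h2.symm
    exact ⟨σ, h⟩

variable {d : ℕ}

/-- Sections of generators are generators or trivial, and wreath recursions can be multiplied and
inverted, so the mother group is closed under taking sections. -/
theorem exists_hasWreathRecursion {d : ℕ} (g : motherGroup d) :
    ∃ (ρ : Equiv.Perm (Fin d)) (s : Fin d → motherGroup d),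
      HasWreathRecursion g.1 (fun x => (s x).1) ρ := by
  obtain ⟨g, hg⟩ := g
  induction hg using Subgroup.closure_induction with
  | mem g hg =>
    rcases id hg with ⟨σ, hσ, rfl⟩ | ⟨σ, ρ, hρ, hσ, hρ0, h⟩
    · exact ⟨σ, fun _ => 1, hasWreathRecursion_rooted σ⟩
    · refine ⟨ρ, fun x => if x.val = 0 then ⟨g, Subgroup.subset_closure hg⟩ else
        ⟨rooted (σ x), Subgroup.subset_closure (Or.inl ⟨σ x, hσ x, rfl⟩)⟩, ?_⟩
      convert h using 2 with x
      by_cases hx : x.val = 0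
      · simp only [hx, if_true]
      · simp only [hx, if_false]
  | one => exact ⟨1, fun _ => 1, HasWreathRecursion.one⟩
  | mul g h _ _ hg hh =>
    obtain ⟨ρ, s, hg⟩ := hg
    obtain ⟨τ, t, hh⟩ := hh
    exact ⟨ρ * τ, fun x => s (τ x) * t x, hg.mul hh⟩
  | inv g _ hg =>
    obtain ⟨ρ, s, hg⟩ := hg
    exact ⟨ρ⁻¹, fun x => (s (ρ⁻¹ x))⁻¹, hg.inv⟩

/-- The action of an element of the mother group on the alphabet. -/
noncomputable def perm (g : motherGroup d) : Equiv.Perm (Fin d) :=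
  (exists_hasWreathRecursion g).choose

/-- The sections of an element of the mother group. -/
noncomputable def sec (g : motherGroup d) : Fin d → motherGroup d :=
  (exists_hasWreathRecursion g).choose_spec.choose

theorem hasWreathRecursion_sec (g : motherGroup d) :
    HasWreathRecursion g.1 (fun x => (sec g x).1) (perm g) :=
  (exists_hasWreathRecursion g).choose_spec.choose_spec

theorem perm_eq_of {g : motherGroup d} {s : Fin d → treeAut d} {ρ : Equiv.Perm (Fin d)}
    (h : HasWreathRecursion g.1 s ρ) : perm g = ρ := (hasWreathRecursion_sec g).perm_eq h

theorem sec_eq_of {g : motherGroup d} {s : Fin d → treeAut d} {ρ : Equiv.Perm (Fin d)}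
    (h : HasWreathRecursion g.1 s ρ) (x : Fin d) : (sec g x).1 = s x :=
  congrFun ((hasWreathRecursion_sec g).sec_eq h) x

theorem perm_mul (g h : motherGroup d) : perm (g * h) = perm g * perm h :=
  perm_eq_of ((hasWreathRecursion_sec g).mul (hasWreathRecursion_sec h))

theorem sec_mul (g h : motherGroup d) (x : Fin d) :
    sec (g * h) x = sec g (perm h x) * sec h x :=
  Subtype.ext (sec_eq_of (g := g * h) ((hasWreathRecursion_sec g).mul (hasWreathRecursion_sec h)) x)

theorem perm_inv (g : motherGroup d) : perm g⁻¹ = (perm g)⁻¹ :=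
  perm_eq_of (hasWreathRecursion_sec g).inv

theorem sec_inv (g : motherGroup d) (x : Fin d) : sec g⁻¹ x = (sec g ((perm g)⁻¹ x))⁻¹ :=
  Subtype.ext (sec_eq_of (g := g⁻¹) (hasWreathRecursion_sec g).inv x)

theorem perm_one : perm (1 : motherGroup d) = 1 := perm_eq_of HasWreathRecursion.one

theorem sec_one (x : Fin d) : sec (1 : motherGroup d) x = 1 :=
  Subtype.ext (sec_eq_of (g := 1) HasWreathRecursion.one x)

/-- The elements of `A` in the mother group. -/
def rootElt : alternatingGroup (Fin d) →* motherGroup d :=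
  ((rootedHom d).comp (alternatingGroup (Fin d)).subtype).codRestrict _ fun σ =>
    Subgroup.subset_closure (Or.inl ⟨σ.1, σ.2, rfl⟩)

theorem perm_rootElt (σ : alternatingGroup (Fin d)) : perm (rootElt σ) = σ.1 :=
  perm_eq_of (hasWreathRecursion_rooted σ.1)

theorem sec_rootElt (σ : alternatingGroup (Fin d)) (x : Fin d) : sec (rootElt σ) x = 1 :=
  Subtype.ext (sec_eq_of (g := rootElt σ) (hasWreathRecursion_rooted σ.1) x)

/-- The element `m` acts as `g` on the words that begin with `i`. -/
def IsLocal (i : Fin d) (g m : motherGroup d) : Prop :=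
  perm m = 1 ∧ ∀ x, sec m x = if x = i then g else 1

theorem IsLocal.mul {i : Fin d} {g h m n : motherGroup d} (hm : IsLocal i g m)
    (hn : IsLocal i h n) : IsLocal i (g * h) (m * n) := by
  refine ⟨by rw [perm_mul, hm.1, hn.1, mul_one], fun x => ?_⟩
  rw [sec_mul, hn.1, Equiv.Perm.one_apply, hm.2, hn.2]
  split_ifs <;> simp

theorem IsLocal.inv {i : Fin d} {g m : motherGroup d} (hm : IsLocal i g m) :
    IsLocal i g⁻¹ m⁻¹ := by
  refine ⟨by rw [perm_inv, hm.1, inv_one], fun x => ?_⟩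
  rw [sec_inv, hm.1, inv_one, Equiv.Perm.one_apply, hm.2]
  split_ifs <;> simp

theorem isLocal_one (i : Fin d) : IsLocal i (1 : motherGroup d) 1 :=
  ⟨perm_one, fun x => by rw [sec_one, ite_self]⟩

theorem IsLocal.conj {i : Fin d} {g m : motherGroup d} (hm : IsLocal i g m)
    (σ : alternatingGroup (Fin d)) :
    IsLocal (σ.1 i) g (rootElt σ * m * rootElt σ⁻¹) := by
  refine ⟨?_, fun x => ?_⟩
  · rw [perm_mul, perm_mul, perm_rootElt, perm_rootElt, hm.1, mul_one]
    exact mul_inv_cancel σ.1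
  · rw [sec_mul, sec_mul, sec_rootElt, sec_rootElt, perm_rootElt, one_mul, mul_one, hm.2]
    refine if_congr ?_ rfl rfl
    exact Equiv.Perm.inv_eq_iff_eq.trans eq_comm |>.trans eq_comm |>.trans Iff.rfl

theorem exists_isLocal_of_exists (hd : 5 ≤ d) {i : Fin d} {g : motherGroup d}
    (h : ∃ m, IsLocal i g m) (j : Fin d) : ∃ m, IsLocal j g m := by
  obtain ⟨m, hm⟩ := h
  obtain ⟨σ, rfl⟩ := exists_alternating_apply_eq hd i j
  exact ⟨_, hm.conj σ⟩

variable [NeZero d]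

/-- The elements of `B` in the mother group. -/
def directedElt (σ : Fin d → alternatingGroup (Fin d)) (ρ : alternatingGroup (Fin d))
    (hρ : ρ.1 0 = 0) : motherGroup d :=
  ⟨directed (fun x => (σ x).1) ρ.1 hρ,
    Subgroup.subset_closure (Or.inr (directed_mem_setB hρ (fun x => (σ x).2) ρ.2))⟩

variable {σ : Fin d → alternatingGroup (Fin d)} {ρ : alternatingGroup (Fin d)} {hρ : ρ.1 0 = 0}

theorem perm_directedElt : perm (directedElt σ ρ hρ) = ρ.1 :=
  perm_eq_of (hasWreathRecursion_directed _ ρ.1 hρ)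

theorem sec_directedElt (x : Fin d) :
    sec (directedElt σ ρ hρ) x = if x = 0 then directedElt σ ρ hρ else rootElt (σ x) := by
  refine Subtype.ext ((sec_eq_of (hasWreathRecursion_directed _ ρ.1 hρ) x).trans ?_)
  by_cases hx : x = 0
  · simp [hx]
    rfl
  · have hx' : x.val ≠ 0 := fun h => hx (Fin.ext (by simpa using h))
    rw [if_neg hx', if_neg hx]
    rfl

theorem exists_eq_directedElt {b : motherGroup d} (hb : b.1 ∈ setB d) :
    ∃ σ ρ hρ, b = directedElt σ ρ hρ := by
  obtain ⟨σ, ρ, hρ, hσ, hρ0, h⟩ := hb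
  exact ⟨fun x => ⟨σ x, hσ x⟩, ⟨ρ, hρ⟩, hρ0 0 rfl, Subtype.ext (eq_directed (hρ0 0 rfl) h)⟩

/-- By perfectness only commutators `⁅α, β⁆` are needed. The element `b α` has section `α` at `e`
and itself at `0`. Conjugating `b β` by the three-cycle `(0 e' f)`, which fixes `e`, moves its
directed part from `0` to `e'` and keeps `β` at `e`. The two elements then have nontrivial sections
in common only at `e`, so their commutator is local there. -/
theorem exists_isLocal_rootElt (hd : 5 ≤ d) (i : Fin d) (σ : alternatingGroup (Fin d)) :
    ∃ m, IsLocal i (rootElt σ) m := by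
  obtain ⟨e, e', ⟨he, -⟩, ⟨he', -⟩, hee⟩ := exists_two_ne hd (0 : Fin d) 0 0
  obtain ⟨f, _, ⟨hf, hfe, hfe'⟩, -⟩ := exists_two_ne hd (0 : Fin d) e e'
  refine exists_isLocal_of_exists hd (i := e) ?_ i
  let K : Subgroup (alternatingGroup (Fin d)) :=
    { carrier := {σ | ∃ m, IsLocal e (rootElt σ) m}
      one_mem' := ⟨1, by rw [map_one]; exact isLocal_one e⟩
      mul_mem' := fun ⟨m, hm⟩ ⟨n, hn⟩ => ⟨m * n, by rw [map_mul]; exact hm.mul hn⟩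
      inv_mem' := fun ⟨m, hm⟩ => ⟨m⁻¹, by rw [map_inv]; exact hm.inv⟩ }
  have hle : commutator (alternatingGroup (Fin d)) ≤ K := by
    rw [commutator_def, Subgroup.commutator_le]
    intro α _ β _
    obtain ⟨τ, -, h1, h2, h3, h4⟩ := exists_threeCycle he'.symm hf.symm hfe'.symm
    let b : alternatingGroup (Fin d) → motherGroup d := fun α =>
      directedElt (fun x => if x = e then α else 1) 1 rfl
    have hb : ∀ α x, sec (b α) x = if x = 0 then b α else if x = e then rootElt α else 1 := by
      intro α x
      refine (sec_directedElt x).trans (if_congr Iff.rfl rfl ?_)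
      split_ifs
      · rfl
      · exact map_one _
    have hb1 : ∀ α, perm (b α) = 1 := fun α => perm_directedElt
    let c := rootElt τ * b β * rootElt τ⁻¹
    have hc1 : perm c = 1 := by
      simp only [c]
      rw [perm_mul, perm_mul, perm_rootElt, perm_rootElt, hb1, mul_one]
      exact mul_inv_cancel τ.1
    have hc : ∀ x, sec c (τ.1 x) = sec (b β) x := by
      intro x
      simp only [c]
      rw [sec_mul, sec_mul, sec_rootElt, sec_rootElt, perm_rootElt, one_mul, mul_one]
      congr 1
      exact τ.1.symm_apply_apply x
    refine ⟨⁅b α, c⁆, ?_, fun x => ?_⟩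
    · rw [commutatorElement_def]
      simp only [perm_mul, perm_inv, hb1, hc1]
      rfl
    have hsec : sec ⁅b α, c⁆ x = ⁅sec (b α) x, sec c x⁆ := by
      rw [commutatorElement_def]
      simp only [sec_mul, sec_inv, perm_inv, hb1, hc1, commutatorElement_def, inv_one,
        Equiv.Perm.one_apply]
    have hτe : τ.1 e = e := h4 e he hee hfe.symm
    rw [hsec, hb]
    by_cases hx0 : x = 0
    · have : sec c x = 1 := by
        rw [hx0, ← h3, hc, hb, if_neg hf, if_neg hfe]
      rw [this, commutatorElement_one_right, if_neg (hx0 ▸ he.symm)]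
    by_cases hxe : x = e
    · have : sec c x = rootElt β := by
        rw [hxe, ← hτe, hc, hb, if_neg he, if_pos rfl]
      rw [this, if_neg hx0, if_pos hxe, if_pos hxe, map_commutatorElement]
    · rw [if_neg hx0, if_neg hxe, if_neg hxe, commutatorElement_one_left]
  rw [commutator_alternatingGroup_eq_top (by simpa using hd)] at hle
  exact hle (Subgroup.mem_top σ)

/-- The permutation `ρ` and the rooted sections away from `0` can be cancelled by rooted elements
and local copies of rooted elements, which leaves only the section at `0`, the element itself. -/
theorem exists_isLocal_directedElt (hd : 5 ≤ d) :
    ∃ m, IsLocal 0 (directedElt σ ρ hρ) m := by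
  have key : ∀ s : Finset (Fin d), ∃ m : motherGroup d, perm m = 1 ∧
      ∀ x, sec m x = if x ∈ s then rootElt (σ x) else 1 := by
    intro s
    induction s using Finset.induction_on with
    | empty => exact ⟨1, perm_one, fun x => by simp [sec_one]⟩
    | insert i s his ih =>
      obtain ⟨m, hm1, hm2⟩ := ih
      obtain ⟨n, hn1, hn2⟩ := exists_isLocal_rootElt hd i (σ i)
      refine ⟨m * n, by rw [perm_mul, hm1, hn1, mul_one], fun x => ?_⟩
      rw [sec_mul, hn1, Equiv.Perm.one_apply, hm2, hn2]
      by_cases hxi : x = i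
      · subst hxi
        simp [his]
      · simp [hxi]
  obtain ⟨m, hm1, hm2⟩ := key (Finset.univ.erase 0)
  refine ⟨rootElt ρ⁻¹ * directedElt σ ρ hρ * m⁻¹, ?_, fun x => ?_⟩
  · rw [perm_mul, perm_mul, perm_inv, hm1, perm_rootElt, perm_directedElt, inv_one, mul_one]
    exact inv_mul_cancel ρ.1
  · rw [sec_mul, sec_mul, sec_rootElt, one_mul, sec_inv, perm_inv, hm1, inv_one,
      Equiv.Perm.one_apply, hm2, sec_directedElt]
    by_cases hx : x = 0 <;> simp [hx]

theorem exists_isLocal (hd : 5 ≤ d) (i : Fin d) (g : motherGroup d) : ∃ m, IsLocal i g m := by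
  obtain ⟨g, hg⟩ := g
  induction hg using Subgroup.closure_induction with
  | mem g hg =>
    rcases id hg with ⟨σ, hσ, rfl⟩ | hB
    · exact exists_isLocal_rootElt hd i ⟨σ, hσ⟩
    · obtain ⟨σ, ρ, hρ, h⟩ := exists_eq_directedElt (b := ⟨g, Subgroup.subset_closure hg⟩) hB
      rw [h]
      exact exists_isLocal_of_exists hd (exists_isLocal_directedElt hd) i
  | one => exact ⟨1, isLocal_one i⟩
  | mul g h hg hh ihg ihh =>
    obtain ⟨m, hm⟩ := ihg
    obtain ⟨n, hn⟩ := ihh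
    exact ⟨m * n, hm.mul hn⟩
  | inv g hg ih =>
    obtain ⟨m, hm⟩ := ih
    exact ⟨m⁻¹, hm.inv⟩

/-- A bound on the number of factors from `B` in a product of elements of `A` and `B`. -/
inductive DirectedLength : ℕ → motherGroup d → Prop
  | one : DirectedLength 0 1
  | root_mul {n g} (σ : alternatingGroup (Fin d)) : DirectedLength n g →
      DirectedLength n (rootElt σ * g)
  | directed_mul {n g} (b : motherGroup d) (hb : b.1 ∈ setB d) : DirectedLength n g →
      DirectedLength (n + 1) (b * g)

theorem exists_directedLength (g : motherGroup d) : ∃ n, DirectedLength n g := by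
  obtain ⟨g, hg⟩ := g
  have hgen : ∀ x ∈ setA d ∪ setB d, ∀ (hx : x ∈ motherGroup d) (y : motherGroup d),
      (∃ n, DirectedLength n y) → ∃ n, DirectedLength n (⟨x, hx⟩ * y) := by
    rintro x (⟨σ, hσ, rfl⟩ | hxB) hx y ⟨n, hn⟩
    · exact ⟨n, DirectedLength.root_mul ⟨σ, hσ⟩ hn⟩
    · exact ⟨n + 1, DirectedLength.directed_mul _ hxB hn⟩
  induction hg using Subgroup.closure_induction_left with
  | one => exact ⟨0, DirectedLength.one⟩
  | mul_left x hx y hy ih => exact hgen x hx (Subgroup.subset_closure hx) _ ih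
  | inv_mul_cancel x hx y hy ih =>
    refine hgen x⁻¹ ?_ (inv_mem (Subgroup.subset_closure hx)) _ ih
    rcases hx with hx | hx
    · exact Or.inl (mem_subgroupA.1 (inv_mem (mem_subgroupA.2 hx)))
    · exact Or.inr ((subgroupB d).inv_mem hx)

/-- The mother group is contracting. -/
theorem DirectedLength.sec {n : ℕ} {g : motherGroup d} (h : DirectedLength n g) (x : Fin d) :
    sec g x = 1 ∨ (0 < n ∧ (sec g x).1 ∈ setB d) ∨ ∃ m < n, DirectedLength m (sec g x) := by
  induction h with
  | one => exact Or.inl (sec_one x)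
  | root_mul σ _ ih => rwa [sec_mul, sec_rootElt, one_mul]
  | @directed_mul n g b hb hg ih =>
    rw [sec_mul]
    set y := perm g x
    set u := MotherGroup.sec g x
    have hby : (MotherGroup.sec b y).1 ∈ setB d ∨ ∃ σ, MotherGroup.sec b y = rootElt σ := by
      obtain ⟨σ, ρ, hρ, rfl⟩ := exists_eq_directedElt hb
      rw [sec_directedElt]
      split_ifs
      · exact Or.inl hb
      · exact Or.inr ⟨_, rfl⟩
    rcases hby with hbB | ⟨σ, hσ⟩
    -- Since `B` is a group, two directed sections merge into one. A section in `B` is kept as a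
    -- separate case, because its length need not drop when `n = 1`.
    · rcases ih with h1 | ⟨-, hu⟩ | ⟨m, hm, hu⟩
      · rw [h1, mul_one]
        exact Or.inr (Or.inl ⟨n.succ_pos, hbB⟩)
      · exact Or.inr (Or.inl ⟨n.succ_pos, (subgroupB d).mul_mem hbB hu⟩)
      · exact Or.inr (Or.inr ⟨m + 1, Nat.succ_lt_succ hm, DirectedLength.directed_mul _ hbB hu⟩)
    · rw [hσ]
      rcases ih with h1 | ⟨hn, hu⟩ | ⟨m, hm, hu⟩
      · rw [h1]
        exact Or.inr (Or.inr ⟨0, n.succ_pos, DirectedLength.root_mul σ DirectedLength.one⟩)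
      -- A rooted element times an element of `B` has one directed factor; `1 < n + 1` holds thanks
      -- to the recorded `0 < n`.
      · refine Or.inr (Or.inr ⟨1, Nat.succ_lt_succ hn, DirectedLength.root_mul σ ?_⟩)
        have := DirectedLength.directed_mul u hu DirectedLength.one
        rwa [mul_one] at this
      · exact Or.inr (Or.inr ⟨m, hm.trans n.lt_succ_self, DirectedLength.root_mul σ hu⟩)

end Mother

/-! ## The space of subgroups -/

section SpaceOfSubgroups

variable {G Y : Type*} [Group G] [TopologicalSpace Y]

open Classical in
theorem continuous_sub_iff {f : Y → Sub G} :
    Continuous f ↔ ∀ g : G, IsClopen {y | g ∈ f y} := by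
  rw [continuous_induced_rng, continuous_pi_iff]
  refine forall_congr' fun g => ?_
  rw [continuous_bool_rng true]
  have : {y | g ∈ f y} = ((fun y => decide (g ∈ f y)) ⁻¹' {true}) := by
    ext y
    simp
  rw [this]
  rfl

theorem isClopen_setOf_mem (g : G) : IsClopen {K : Sub G | g ∈ K} :=
  continuous_sub_iff.1 continuous_id g

instance : TotallySeparatedSpace (Sub G) := by
  rw [totallySeparatedSpace_iff_exists_isClopen]
  intro H K hHK
  by_cases h : H ≤ K
  · obtain ⟨g, hgK, hgH⟩ := SetLike.not_le_iff_exists.1 fun h' => hHK (le_antisymm h h')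
    exact ⟨_, (isClopen_setOf_mem g).compl, hgH, fun h => h hgK⟩
  · obtain ⟨g, hgH, hgK⟩ := SetLike.not_le_iff_exists.1 h
    exact ⟨_, isClopen_setOf_mem g, hgH, hgK⟩

-- The subgroup axioms are closed conditions on `G → Bool`, a compact space by Tychonoff.
open Classical in
instance : CompactSpace (Sub G) := by
  have hrange : Set.range (fun (H : Subgroup G) (g : G) => decide (g ∈ H)) =
      {f | f 1 = true} ∩ (⋂ a, ⋂ b, {f | f a = true → f b = true → f (a * b) = true}) ∩
        ⋂ a, {f | f a = true → f a⁻¹ = true} := by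
    ext f
    simp only [Set.mem_range, Set.mem_inter_iff, Set.mem_iInter, Set.mem_ofPred_eq]
    constructor
    · rintro ⟨H, rfl⟩
      simp only [decide_eq_true_eq]
      exact ⟨⟨one_mem H, fun a b => mul_mem⟩, fun a => inv_mem⟩
    · rintro ⟨⟨h1, h2⟩, h3⟩
      let H : Subgroup G :=
        { carrier := {g | f g = true}
          one_mem' := h1
          mul_mem' := fun ha hb => h2 _ _ ha hb
          inv_mem' := fun ha => h3 _ ha }
      have hH : ∀ g, g ∈ H ↔ f g = true := fun g => Iff.rfl
      exact ⟨H, funext fun g => by simp [hH]⟩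
  have hc : ∀ g : G, IsClopen {f : G → Bool | f g = true} := fun g =>
    (isClopen_discrete {true}).preimage (continuous_apply g)
  have himp : ∀ {p q : Set (G → Bool)}, IsClopen p → IsClosed q → IsClosed {f | f ∈ p → f ∈ q} := by
    intro p q hp hq
    simp only [imp_iff_not_or]
    exact hp.compl.isClosed.union hq
  refine IsClosedEmbedding.compactSpace (f := fun (H : Subgroup G) (g : G) => decide (g ∈ H))
    ⟨⟨⟨rfl⟩, fun H K h => ?_⟩, ?_⟩
  · ext g
    exact decide_eq_decide.1 (congrFun h g)
  · rw [hrange]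
    refine ((hc 1).isClosed.inter ?_).inter ?_
    · exact isClosed_iInter fun a => isClosed_iInter fun b =>
        himp (hc a) (himp (hc b) (hc (a * b)).isClosed)
    · exact isClosed_iInter fun a => himp (hc a) (hc a⁻¹).isClosed

instance [MulAction G Y] : CompactSpace (stabilitySystem G Y) :=
  isCompact_iff_compactSpace.1 isClosed_closure.isCompact

instance [MulAction G Y] : TotallyDisconnectedSpace (stabilitySystem G Y) :=
  Subtype.totallyDisconnectedSpace

end SpaceOfSubgroups

/-! ## The self-similar structure of the Schreier dynamical system -/

section Schreier

variable {d : ℕ}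

/-- The infinite word `iγ`. -/
def Boundary.cons (i : Fin d) (γ : Boundary d) : Boundary d := fun n => Nat.casesOn n i γ

/-- The infinite word without its first letter. -/
def Boundary.tail (γ : Boundary d) : Boundary d := fun n => γ (n + 1)

theorem Boundary.cons_tail (γ : Boundary d) : Boundary.cons (γ 0) γ.tail = γ := by
  funext n
  cases n <;> rfl

theorem Boundary.continuous_cons (i : Fin d) : Continuous (Boundary.cons i) := by
  refine continuous_pi fun n => ?_
  cases n with
  | zero => exact continuous_const
  | succ n => exact continuous_apply (A := fun _ : ℕ => Fin d) n

theorem Boundary.continuous_tail : Continuous (Boundary.tail (d := d)) :=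
  continuous_pi fun n => continuous_apply (A := fun _ : ℕ => Fin d) (n + 1)

theorem Boundary.isOpen_setOf_zero_eq (i : Fin d) : IsOpen {γ : Boundary d | γ 0 = i} :=
  (isOpen_discrete {i}).preimage (continuous_apply (A := fun _ : ℕ => Fin d) 0)

theorem Boundary.pre_cons (i : Fin d) (γ : Boundary d) (n : ℕ) :
    (Boundary.cons i γ).pre (n + 1) = i :: γ.pre n := by
  simp [Boundary.pre, List.ofFn_succ, Boundary.cons]

theorem Boundary.cons_inj {i j : Fin d} {γ η : Boundary d} :
    Boundary.cons i γ = Boundary.cons j η ↔ i = j ∧ γ = η :=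
  ⟨fun h => ⟨congrFun h 0, funext fun n => congrFun h (n + 1)⟩, fun ⟨h, h'⟩ => by rw [h, h']⟩

theorem smul_cons (g : motherGroup d) (i : Fin d) (γ : Boundary d) :
    g • Boundary.cons i γ = Boundary.cons (perm g i) (sec g i • γ) := by
  refine Boundary.ext_pre fun n => ?_
  cases n with
  | zero => rfl
  | succ n =>
    refine (pre_boundaryAct g.1 _ _).trans ?_
    rw [Boundary.pre_cons, Boundary.pre_cons, hasWreathRecursion_sec g]
    congr 1
    exact (pre_boundaryAct (sec g i).1 γ n).symm

/-- The stabiliser of `iγ` in terms of the stabiliser of `γ`. -/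
noncomputable def stabCons (i : Fin d) (K : Sub (motherGroup d)) : Sub (motherGroup d) where
  carrier := {g | perm g i = i ∧ sec g i ∈ K}
  one_mem' := ⟨by rw [perm_one]; rfl, by rw [sec_one]; exact one_mem K⟩
  mul_mem' := by
    rintro g h ⟨hg, hg'⟩ ⟨hh, hh'⟩
    refine ⟨by rw [perm_mul, Equiv.Perm.mul_apply, hh, hg], ?_⟩
    rw [sec_mul, hh]
    exact mul_mem hg' hh'
  inv_mem' := by
    rintro g ⟨hg, hg'⟩
    have h : (perm g)⁻¹ i = i := by rw [Equiv.Perm.inv_eq_iff_eq, hg]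
    refine ⟨by rw [perm_inv, h], ?_⟩
    rw [sec_inv, h]
    exact inv_mem hg'

theorem mem_stabCons {i : Fin d} {K : Sub (motherGroup d)} {g : motherGroup d} :
    g ∈ stabCons i K ↔ perm g i = i ∧ sec g i ∈ K := Iff.rfl

theorem stabMap_cons (i : Fin d) (γ : Boundary d) :
    stabMap (motherGroup d) _ (Boundary.cons i γ) = stabCons i (stabMap (motherGroup d) _ γ) := by
  ext g
  change g • Boundary.cons i γ = _ ↔ _
  rw [smul_cons, Boundary.cons_inj]
  rfl

theorem continuous_stabCons (i : Fin d) : Continuous (stabCons i) :=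
  continuous_sub_iff.2 fun g => by
    by_cases h : perm g i = i
    · simpa only [mem_stabCons, h, true_and] using isClopen_setOf_mem (sec g i)
    · simp only [mem_stabCons, h, false_and, Set.ofPred_false]
      exact isClopen_empty

theorem smul_stabCons (g : motherGroup d) (i : Fin d) (K : Sub (motherGroup d)) :
    g • stabCons i K = stabCons (perm g i) (sec g i • K) := by
  ext k
  rw [mem_smul_sub, mem_stabCons, mem_stabCons, mem_smul_sub, perm_mul, perm_mul, perm_inv,
    Equiv.Perm.mul_apply, Equiv.Perm.mul_apply, Equiv.Perm.inv_eq_iff_eq]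
  refine and_congr_right fun h => ?_
  rw [sec_mul, sec_mul, sec_inv, h, show (perm g)⁻¹ (perm g i) = i from
    (perm g).symm_apply_apply i]

/-- If the letters differed, a rooted three-cycle fixing `i` and moving `j` would lie in the first
subgroup and not in the second. -/
theorem eq_of_stabCons_eq (hd : 5 ≤ d) {i j : Fin d} {K L : Sub (motherGroup d)}
    (h : stabCons i K = stabCons j L) : i = j := by
  by_contra hij
  obtain ⟨k, l, ⟨hki, hkj, -⟩, ⟨hli, hlj, -⟩, hkl⟩ := exists_two_ne hd i j j
  obtain ⟨σ, -, h1, -, -, h4⟩ := exists_threeCycle hkj.symm hlj.symm hkl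
  have hmem : rootElt σ ∈ stabCons i K :=
    ⟨by rw [perm_rootElt, h4 i hij hki.symm hli.symm], by rw [sec_rootElt]; exact one_mem K⟩
  rw [h, mem_stabCons, perm_rootElt, h1] at hmem
  exact hkj hmem.1

/-- The element that acts as `g` on the words that begin with `i`. -/
noncomputable def localElt [NeZero d] (hd : 5 ≤ d) (i : Fin d) (g : motherGroup d) :
    motherGroup d := (exists_isLocal hd i g).choose

variable [NeZero d]

theorem isLocal_localElt (hd : 5 ≤ d) (i : Fin d) (g : motherGroup d) : IsLocal i g (localElt hd i g) :=
  (exists_isLocal hd i g).choose_spec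

theorem localElt_mem_stabCons (hd : 5 ≤ d) {i : Fin d} {K : Sub (motherGroup d)} {g : motherGroup d} :
    localElt hd i g ∈ stabCons i K ↔ g ∈ K := by
  obtain ⟨h1, h2⟩ := isLocal_localElt hd i g
  rw [mem_stabCons, h1, h2, if_pos rfl]
  exact and_iff_right rfl

theorem stabCons_injective (hd : 5 ≤ d) (i : Fin d) : Function.Injective (stabCons i) := fun K L h => by
  ext g
  rw [← localElt_mem_stabCons hd (i := i), h, localElt_mem_stabCons]

/-- The map `stabCons i` is an embedding, being continuous and injective from a compact to a
Hausdorff space, and it intertwines the stabiliser map with prefixing by `i`. So the points that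
define the Schreier system are stable under adding and removing letters. -/
theorem continuousAt_stabMap_cons (hd : 5 ≤ d) {i : Fin d} {γ : Boundary d} :
    ContinuousAt (stabMap (motherGroup d) (Boundary d)) (Boundary.cons i γ) ↔
      ContinuousAt (stabMap (motherGroup d) (Boundary d)) γ := by
  constructor
  · intro h
    have hemb : IsEmbedding (stabCons (d := d) i) :=
      ((continuous_stabCons i).isClosedEmbedding (stabCons_injective hd i)).isEmbedding
    rw [hemb.isInducing.continuousAt_iff]
    refine (ContinuousAt.comp (f := Boundary.cons i) h
      (Boundary.continuous_cons i).continuousAt).congr ?_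
    exact Eventually.of_forall fun η => stabMap_cons i η
  · intro h
    have h' : ContinuousAt (fun η : Boundary d => stabCons i (stabMap (motherGroup d) _ η.tail))
        (Boundary.cons i γ) :=
      (continuous_stabCons i).continuousAt.comp
        (ContinuousAt.comp (f := Boundary.tail) h Boundary.continuous_tail.continuousAt)
    refine h'.congr ?_
    filter_upwards [(Boundary.isOpen_setOf_zero_eq i).mem_nhds (x := Boundary.cons i γ) rfl]
      with η hη
    rw [← stabMap_cons]
    have hη : η 0 = i := hη
    rw [← hη, Boundary.cons_tail]

theorem stabCons_mem (hd : 5 ≤ d) {i : Fin d} {K : Sub (motherGroup d)}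
    (hK : K ∈ stabilitySystem (motherGroup d) (Boundary d)) :
    stabCons i K ∈ stabilitySystem (motherGroup d) (Boundary d) := by
  refine map_mem_closure (continuous_stabCons i) hK ?_
  rintro _ ⟨γ, hγ, rfl⟩
  exact ⟨Boundary.cons i γ, (continuousAt_stabMap_cons hd).2 hγ, stabMap_cons i γ⟩

/-- The finitely many images under `stabCons i` are compact, so their union is closed. It contains
the stabiliser of each continuity point, by removing the first letter, and hence the closure. -/
theorem exists_eq_stabCons (hd : 5 ≤ d) {K : Sub (motherGroup d)}
    (hK : K ∈ stabilitySystem (motherGroup d) (Boundary d)) :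
    ∃ i, ∃ L ∈ stabilitySystem (motherGroup d) (Boundary d), stabCons i L = K := by
  have hclosed : IsClosed (⋃ i, stabCons i '' stabilitySystem (motherGroup d) (Boundary d)) :=
    isClosed_iUnion_of_finite fun i =>
      (isClosed_closure.isCompact.image (continuous_stabCons i)).isClosed
  have hsub : stabilitySystem (motherGroup d) (Boundary d) ⊆
      ⋃ i, stabCons i '' stabilitySystem (motherGroup d) (Boundary d) := by
    refine closure_minimal ?_ hclosed
    rintro _ ⟨γ, hγ, rfl⟩
    have hγ' : ContinuousAt (stabMap (motherGroup d) (Boundary d)) γ.tail := by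
      rw [← continuousAt_stabMap_cons hd (i := γ 0), Boundary.cons_tail]
      exact hγ
    refine Set.mem_iUnion.2 ⟨γ 0, _, subset_closure ⟨γ.tail, hγ', rfl⟩, ?_⟩
    rw [← stabMap_cons, Boundary.cons_tail]
  obtain ⟨i, L, hL, h⟩ := Set.mem_iUnion.1 (hsub hK)
  exact ⟨i, L, hL, h⟩

/-- The identification of the Schreier dynamical system with `d` copies of itself. -/
noncomputable def schreierHomeo (hd : 5 ≤ d) : Fin d × SchreierSystem d ≃ₜ SchreierSystem d :=
  Continuous.homeoOfEquivCompactToT2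
    (f := Equiv.ofBijective (fun z => ⟨stabCons z.1 z.2.1, stabCons_mem hd z.2.2⟩) <| by
      constructor
      · rintro ⟨i, K⟩ ⟨j, L⟩ h
        have h := congrArg Subtype.val h
        obtain rfl : i = j := eq_of_stabCons_eq hd h
        exact Prod.ext rfl (Subtype.ext (stabCons_injective hd _ h))
      · rintro ⟨K, hK⟩
        obtain ⟨i, L, hL, h⟩ := exists_eq_stabCons hd hK
        exact ⟨(i, ⟨L, hL⟩), Subtype.ext h⟩)
    (continuous_prod_of_discrete_left.2 fun i =>
      ((continuous_stabCons i).comp continuous_subtype_val).subtype_mk _)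

theorem smul_schreierHomeo (hd : 5 ≤ d) (g : motherGroup d) (i : Fin d) (K : SchreierSystem d) :
    g • schreierHomeo hd (i, K) = schreierHomeo hd (perm g i, sec g i • K) :=
  Subtype.ext (smul_stabCons g i K.1)

/-- The action of the mother group on its Schreier dynamical system is self-similar. -/
noncomputable def schreierSelfSimilarity (hd : 5 ≤ d) :
    SelfSimilarity (motherGroup d) (SchreierSystem d) d where
  toHomeo := schreierHomeo hd
  perm := perm
  sec := sec
  smul_apply := smul_schreierHomeo hd
  loc := localElt hd
  loc_smul i g j x := by
    obtain ⟨h1, h2⟩ := isLocal_localElt hd i g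
    rw [smul_schreierHomeo, h1, h2]
    split_ifs
    · rfl
    · rw [one_smul]
      rfl
  root := rootElt
  root_smul σ j x := by
    rw [smul_schreierHomeo, perm_rootElt, sec_rootElt, one_smul]

end Schreier

/-! ## Generation of the algebra of clopen sets -/

section Algebra

variable {G X : Type*} [Group G] [MulAction G X] {A : Set (Set X)}

namespace IsInvariantAlgebra

theorem empty_mem (hA : IsInvariantAlgebra G A) : ∅ ∈ A := by
  rw [← Set.compl_univ]
  exact hA.compl_mem _ hA.univ_mem

theorem union_mem (hA : IsInvariantAlgebra G A) {U V : Set X} (hU : U ∈ A) (hV : V ∈ A) :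
    U ∪ V ∈ A := by
  rw [← compl_compl (U ∪ V), Set.compl_union]
  exact hA.compl_mem _ (hA.inter_mem _ (hA.compl_mem _ hU) _ (hA.compl_mem _ hV))

theorem iUnion_mem (hA : IsInvariantAlgebra G A) {ι : Type*} [Finite ι] {f : ι → Set X}
    (hf : ∀ i, f i ∈ A) : ⋃ i, f i ∈ A := by
  have := Fintype.ofFinite ι
  have key : ∀ s : Finset ι, ⋃ i ∈ s, f i ∈ A := by
    intro s
    classical
    induction s using Finset.induction_on with
    | empty => simpa using hA.empty_mem
    | insert i s _ ih =>
      rw [Finset.set_biUnion_insert]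
      exact hA.union_mem (hf i) ih
  simpa using key Finset.univ

/-- An algebra of sets with enough clopen sets to separate the points of a compact space contains
all clopen sets. -/
theorem mem_of_isClopen [TopologicalSpace X] [CompactSpace X] (hA : IsInvariantAlgebra G A)
    (hsep : ∀ x y : X, x ≠ y → ∃ S ∈ A, IsClopen S ∧ x ∈ S ∧ y ∉ S) {V : Set X}
    (hV : IsClopen V) : V ∈ A := by
  have hloc : ∀ x ∈ V, ∃ S ∈ A, IsClopen S ∧ x ∈ S ∧ S ⊆ V := by
    intro x hx
    -- Compactness of `Vᶜ` gives a set of the algebra between a point and `V`; compactness of `V`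
    -- then makes `V` a finite union of such sets.
    obtain ⟨S, hS, hSc, hxS, h⟩ := hV.compl.isClosed.isCompact.induction_on
      (p := fun T => ∃ S ∈ A, IsClopen S ∧ x ∈ S ∧ T ⊆ Sᶜ)
      ⟨Set.univ, hA.univ_mem, isClopen_univ, Set.mem_univ x, Set.empty_subset _⟩
      (fun s t hst ⟨S, h1, h2, h3, h4⟩ => ⟨S, h1, h2, h3, hst.trans h4⟩)
      (fun s t ⟨S, h1, h2, h3, h4⟩ ⟨S', h1', h2', h3', h4'⟩ =>
        ⟨S ∩ S', hA.inter_mem _ h1 _ h1', h2.inter h2', ⟨h3, h3'⟩, by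
          rw [Set.compl_inter]
          exact Set.union_subset_union h4 h4'⟩)
      (fun y hy => by
        obtain ⟨S, h1, h2, h3, h4⟩ := hsep x y fun e => hy (e ▸ hx)
        exact ⟨Sᶜ, mem_nhdsWithin_of_mem_nhds (h2.compl.isOpen.mem_nhds h4), S, h1, h2, h3,
          subset_rfl⟩)
    exact ⟨S, hS, hSc, hxS, Set.compl_subset_compl.1 h⟩
  obtain ⟨S, hS, hVS, hSV⟩ := hV.isClosed.isCompact.induction_on
    (p := fun T => ∃ S ∈ A, T ⊆ S ∧ S ⊆ V)
    ⟨∅, hA.empty_mem, subset_rfl, Set.empty_subset _⟩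
    (fun s t hst ⟨S, h1, h2, h3⟩ => ⟨S, h1, hst.trans h2, h3⟩)
    (fun s t ⟨S, h1, h2, h3⟩ ⟨S', h1', h2', h3'⟩ =>
      ⟨S ∪ S', hA.union_mem h1 h1', Set.union_subset_union h2 h2', Set.union_subset h3 h3'⟩)
    (fun x hx => by
      obtain ⟨S, h1, h2, h3, h4⟩ := hloc x hx
      exact ⟨S, mem_nhdsWithin_of_mem_nhds (h2.isOpen.mem_nhds h3), S, h1, subset_rfl, h4⟩)
  rwa [hVS.antisymm hSV]

end IsInvariantAlgebra

end Algebra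

/-! ### Fixed-point sets of `B` and the clopen sets of the Schreier system -/

section Schreier

variable {d : ℕ}

/-- The points of the Schreier dynamical system fixed by `g`, as a clopen set. -/
def fixSet (g : motherGroup d) : Set (SchreierSystem d) := {K | g ∈ K.1}

theorem isClopen_fixSet (g : motherGroup d) : IsClopen (fixSet g) :=
  (isClopen_setOf_mem g).preimage continuous_subtype_val

theorem fixSet_one : fixSet (1 : motherGroup d) = Set.univ :=
  Set.eq_univ_of_forall fun K => one_mem K.1

variable [NeZero d] (hd : 5 ≤ d)

theorem schreierHomeo_mem_fixSet {i : Fin d} {K : SchreierSystem d} {g : motherGroup d} :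
    schreierHomeo hd (i, K) ∈ fixSet g ↔ perm g i = i ∧ K ∈ fixSet (sec g i) := Iff.rfl

/-- The copy of a set inside of the cylinder of a letter. -/
def cylinder (i : Fin d) (V : Set (SchreierSystem d)) : Set (SchreierSystem d) :=
  (fun K => schreierHomeo hd (i, K)) '' V

theorem mem_cylinder {i j : Fin d} {K : SchreierSystem d} {V : Set (SchreierSystem d)} :
    schreierHomeo hd (j, K) ∈ cylinder hd i V ↔ j = i ∧ K ∈ V := by
  constructor
  · rintro ⟨L, hL, h⟩
    obtain ⟨rfl, rfl⟩ := Prod.mk.inj ((schreierHomeo hd).injective h)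
    exact ⟨rfl, hL⟩
  · rintro ⟨rfl, h⟩
    exact ⟨K, h, rfl⟩

theorem schreier_set_ext {V W : Set (SchreierSystem d)}
    (h : ∀ i K, schreierHomeo hd (i, K) ∈ V ↔ schreierHomeo hd (i, K) ∈ W) : V = W := by
  ext x
  obtain ⟨⟨i, K⟩, rfl⟩ := (schreierHomeo hd).surjective x
  exact h i K

theorem rootElt_smul (σ : alternatingGroup (Fin d)) (i : Fin d) (K : SchreierSystem d) :
    rootElt σ • schreierHomeo hd (i, K) = schreierHomeo hd (σ.1 i, K) :=
  (schreierSelfSimilarity hd).root_smul σ i K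

theorem localElt_smul (i : Fin d) (g : motherGroup d) (j : Fin d) (K : SchreierSystem d) :
    localElt hd i g • schreierHomeo hd (j, K) =
      schreierHomeo hd (j, if j = i then g • K else K) :=
  (schreierSelfSimilarity hd).loc_smul i g j K

/-- Take `b ∈ B` with section `τ` at `e`, itself at `0`, and trivial sections elsewhere: its
non-fixed set lies over `0` and `e`. Intersecting with the translate by a rooted `σ` that fixes `e`
and moves `0` leaves only the part over `e`, the copy of the set not fixed by `τ`. Since `τ` moves
the letter `0`, local rooted elements translate this part over the whole cylinder of `e`. -/
theorem cylinder_univ_mem {A : Set (Set (SchreierSystem d))}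
    (hA : IsInvariantAlgebra (motherGroup d) A)
    (hB : ∀ b : motherGroup d, b.1 ∈ setB d → fixSet b ∈ A) (i : Fin d) :
    cylinder hd i Set.univ ∈ A := by
  obtain ⟨e, f, ⟨he, -⟩, ⟨hf, -⟩, hef⟩ := exists_two_ne hd (0 : Fin d) 0 0
  obtain ⟨h, _, ⟨h0, hhe, hhf⟩, -⟩ := exists_two_ne hd (0 : Fin d) e f
  obtain ⟨τ, -, τ0, -⟩ := exists_threeCycle he.symm hf.symm hef
  obtain ⟨σ, -, σ0, -, σh, σl⟩ := exists_threeCycle hf.symm h0.symm hhf.symm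
  have σe : σ.1 e = e := σl e he hef hhe.symm
  set b := directedElt (fun x => if x = e then τ else 1) 1 rfl with hb
  have hbsec : ∀ x, sec b x = if x = 0 then b else if x = e then rootElt τ else 1 := fun x => by
    refine (sec_directedElt x).trans (if_congr Iff.rfl rfl ?_)
    split_ifs
    · rfl
    · exact map_one _
  have hbperm : perm b = 1 := perm_directedElt
  have hW : (fixSet b)ᶜ ∈ A :=
    hA.compl_mem _ (hB b (directed_mem_setB rfl (fun x => Subtype.property _) (one_mem _)))
  -- the part of `W` that lies over the letter `e`
  have hE : cylinder hd e (fixSet (rootElt τ))ᶜ ∈ A := by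
    have := hA.inter_mem _ hW _ (hA.smul_mem (rootElt σ) _ hW)
    convert this using 1
    refine schreier_set_ext hd fun j K => ?_
    rw [mem_cylinder, Set.mem_inter_iff, Set.mem_preimage, rootElt_smul, Set.mem_compl_iff,
      Set.mem_compl_iff, Set.mem_compl_iff, schreierHomeo_mem_fixSet, schreierHomeo_mem_fixSet,
      hbperm, hbsec, hbsec]
    simp only [Equiv.Perm.one_apply, true_and]
    by_cases hj0 : j = 0
    · subst hj0
      simp [σ0, he.symm, hf, hef.symm, fixSet_one]
    by_cases hje : j = e
    · subst hje
      simp [σe, he]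
    · simp [hj0, hje, fixSet_one]
  have hC : cylinder hd e Set.univ ∈ A := by
    have := hA.iUnion_mem (f := fun α : alternatingGroup (Fin d) =>
      (localElt hd e (rootElt α) • ·) ⁻¹' cylinder hd e (fixSet (rootElt τ))ᶜ)
      fun α => hA.smul_mem _ _ hE
    convert this using 1
    refine schreier_set_ext hd fun j K => ?_
    simp only [Set.mem_iUnion, Set.mem_preimage, localElt_smul, mem_cylinder, Set.mem_univ,
      and_true]
    refine ⟨fun hj => ?_, fun ⟨α, hα⟩ => hα.1⟩
    obtain ⟨⟨k, L⟩, rfl⟩ := (schreierHomeo hd).surjective K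
    obtain ⟨α, hα⟩ := exists_alternating_apply_eq hd k 0
    refine ⟨α, hj, ?_⟩
    rw [if_pos hj, rootElt_smul, hα, Set.mem_compl_iff, schreierHomeo_mem_fixSet, perm_rootElt, τ0]
    exact fun h => he h.1
  obtain ⟨α, hα⟩ := exists_alternating_apply_eq hd i e
  have := hA.smul_mem (rootElt α) _ hC
  convert this using 1
  refine schreier_set_ext hd fun j K => ?_
  rw [mem_cylinder, Set.mem_preimage, rootElt_smul, mem_cylinder, ← hα, α.1.injective.eq_iff]

theorem isInvariantAlgebra_cylinder {A : Set (Set (SchreierSystem d))}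
    (hA : IsInvariantAlgebra (motherGroup d) A) {i : Fin d}
    (hC : cylinder hd i Set.univ ∈ A) :
    IsInvariantAlgebra (motherGroup d) {V | cylinder hd i V ∈ A} where
  univ_mem := hC
  compl_mem V hV := by
    have := hA.inter_mem _ hC _ (hA.compl_mem _ hV)
    rw [Set.mem_ofPred_eq]
    convert this using 1
    refine schreier_set_ext hd fun j K => ?_
    simp only [mem_cylinder, Set.mem_inter_iff, Set.mem_compl_iff, Set.mem_univ]
    tauto
  inter_mem V hV W hW := by
    have := hA.inter_mem _ hV _ hW
    rw [Set.mem_ofPred_eq]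
    convert this using 1
    refine schreier_set_ext hd fun j K => ?_
    simp only [mem_cylinder, Set.mem_inter_iff]
    tauto
  smul_mem g V hV := by
    have := hA.smul_mem (localElt hd i g) _ hV
    rw [Set.mem_ofPred_eq]
    convert this using 1
    refine schreier_set_ext hd fun j K => ?_
    simp only [mem_cylinder, Set.mem_preimage, localElt_smul]
    refine and_congr_right fun hj => ?_
    rw [if_pos hj]

/-- An element of `B` fixes `0` and is its own section there, so over `0` its fixed-point set is a
copy of itself; a rooted element carries this copy to `i`. -/
theorem cylinder_fixSet_mem {A : Set (Set (SchreierSystem d))}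
    (hA : IsInvariantAlgebra (motherGroup d) A)
    (hB : ∀ b : motherGroup d, b.1 ∈ setB d → fixSet b ∈ A) (i : Fin d) {b : motherGroup d}
    (hb : b.1 ∈ setB d) : cylinder hd i (fixSet b) ∈ A := by
  obtain ⟨α, hα⟩ := exists_alternating_apply_eq hd i 0
  have := hA.smul_mem (rootElt α) _
    (hA.inter_mem _ (hB b hb) _ (cylinder_univ_mem hd hA hB 0))
  convert this using 1
  refine schreier_set_ext hd fun j K => ?_
  rw [mem_cylinder, Set.mem_preimage, rootElt_smul, Set.mem_inter_iff, mem_cylinder,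
    schreierHomeo_mem_fixSet, ← hα, α.1.injective.eq_iff]
  obtain ⟨σ, ρ, hρ, rfl⟩ := exists_eq_directedElt hb
  constructor
  · rintro ⟨rfl, hK⟩
    rw [hα, perm_directedElt, sec_directedElt, if_pos rfl]
    exact ⟨⟨hρ, hK⟩, rfl, Set.mem_univ K⟩
  · rintro ⟨⟨-, hK⟩, rfl, -⟩
    rw [hα, sec_directedElt, if_pos rfl] at hK
    exact ⟨rfl, hK⟩

/-- The sets of fixed points of the elements of `B` generate all sets of fixed points. -/
theorem fixSet_mem (hd : 5 ≤ d) (g : motherGroup d) {A : Set (Set (SchreierSystem d))}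
    (hA : IsInvariantAlgebra (motherGroup d) A)
    (hB : ∀ b : motherGroup d, b.1 ∈ setB d → fixSet b ∈ A) : fixSet g ∈ A := by
  obtain ⟨n, hn⟩ := exists_directedLength g
  induction n using Nat.strong_induction_on generalizing g A with
  | _ n ih =>
    have hsec : ∀ i, cylinder hd i (fixSet (sec g i)) ∈ A := by
      intro i
      -- The sets whose copy over `i` lies in `A` form another invariant algebra containing the
      -- fixed-point sets of `B`. The induction therefore runs over all algebras at once and is
      -- applied to this one when the section is shorter.
      have hA' := isInvariantAlgebra_cylinder hd hA (cylinder_univ_mem hd hA hB i)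
      rcases hn.sec i with h | ⟨-, h⟩ | ⟨m, hm, h⟩
      · rw [h, fixSet_one]
        exact hA'.univ_mem
      · exact cylinder_fixSet_mem hd hA hB i h
      · exact ih m hm (sec g i) hA' (fun b hb => cylinder_fixSet_mem hd hA hB i hb) h
    have := hA.iUnion_mem (f := fun i : {i // perm g i = i} =>
      cylinder hd i.1 (fixSet (sec g i.1))) fun i => hsec i.1
    convert this using 1
    refine schreier_set_ext hd fun j K => ?_
    simp only [Set.mem_iUnion, mem_cylinder, schreierHomeo_mem_fixSet]
    constructor
    · rintro ⟨hj, hK⟩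
      exact ⟨⟨j, hj⟩, rfl, hK⟩
    · rintro ⟨⟨i, hi⟩, rfl, hK⟩
      exact ⟨hi, hK⟩

/-- Distinct points are distinct subgroups, so some `g` lies in exactly one of them and `fixSet g`
or its complement separates them. -/
theorem mem_of_isClopen_schreier (hd : 5 ≤ d) {A : Set (Set (SchreierSystem d))}
    (hA : IsInvariantAlgebra (motherGroup d) A)
    (hB : ∀ b : motherGroup d, b.1 ∈ setB d → fixSet b ∈ A) {V : Set (SchreierSystem d)}
    (hV : IsClopen V) : V ∈ A := by
  refine hA.mem_of_isClopen (fun K L hKL => ?_) hV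
  by_cases h : K.1 ≤ L.1
  · obtain ⟨g, hgL, hgK⟩ := SetLike.not_le_iff_exists.1
      fun h' => hKL (Subtype.ext (le_antisymm h h'))
    exact ⟨_, hA.compl_mem _ (fixSet_mem hd g hA hB), (isClopen_fixSet g).compl, hgK,
      fun h => h hgL⟩
  · obtain ⟨g, hgK, hgL⟩ := SetLike.not_le_iff_exists.1 h
    exact ⟨_, fixSet_mem hd g hA hB, isClopen_fixSet g, hgK, hgL⟩

end Schreier

/-! ### Conclusion for the mother group -/

theorem fg_commutator_fullGroupT (d : ℕ) (hd : 5 ≤ d) :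
    Group.FG (commutator (fullGroupT d)) := by
  have : NeZero d := ⟨by omega⟩
  have hinj : Function.Injective fun g : motherGroup d => g.1 := Subtype.val_injective
  refine (schreierSelfSimilarity hd).fg_commutator_torsionGenerated_full hd
    (s := (fun g : motherGroup d => g.1) ⁻¹' (setA d ∪ setB d))
    (D := fixSet '' {b : motherGroup d | b.1 ∈ setB d}) ?_ ?_ ?_ ?_ ?_ ?_
  · exact (finite_setA.union finite_setB).preimage hinj.injOn
  · exact fun g hg => Submonoid.isOfFinOrder_coe.1 (isOfFinOrder_of_mem hg)
  · exact Subgroup.closure_closure_coe_preimage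
  · exact (finite_setB.preimage hinj.injOn).image _
  · rintro _ ⟨b, -, rfl⟩
    exact isClopen_fixSet b
  · exact fun A hA hD U hU => mem_of_isClopen_schreier hd hA (fun b hb => hD ⟨b, hb, rfl⟩) hU

end MotherGroup

theorem theoremT (d : ℕ) (hd : 5 ≤ d) :
    Group.FG (commutator (MotherGroup.fullGroupT d)) := by
  exact MotherGroup.fg_commutator_fullGroupT d hd
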